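/- Let $A\in(\mathbb Z_{\ge 0})^{V\times V}$ be the (possibly weighted) adjacency matrix of a graph with finite node set $V$, $n=|V|$, in which every node $u$ has positive degree $d_u=\sum_{w\in V}A_{uw}>0$. Write $A_{u*}$ for the $u$-th row of $A$ and $n_{uv}=A_{u*}A_{v*}^\top$. For $q\ge 1$ let $R\in\mathbb R^{q\times n}$ be a random matrix whose entries are independent normal random variables with mean $0$ and variance $1/q$, and let $X=AR^\top\in\mathbb R^{n\times q}$, with rows $X_{u*}$. (a) For all $u,v\in V$, the dot product $X_{u*}X_{v*}^\top$ is asymptotically normal with mean $n_{uv}$ and variance $(n_{uu}n_{vv}+n_{uv}^2)/q$, that is, as $q\to\infty$, $$\frac{X_{u*}X_{v*}^\top-n_{uv}}{\sqrt{n_{uu}n_{vv}+n_{uv}^2}}\,\sqrt q\ \xrightarrow{\ d\ }\ \mathcal N(0,1).$$ (b) Suppose $n\ge 2$, and let $\varepsilon,\delta\in(0,1)$. If $$q\ \ge\ 4\,\frac{1+\varepsilon}{\varepsilon^2}\,\log\frac{n(n-1)}{\delta},$$ then with probability at least $1-\delta$ the inequality $$\left|X_{u*}X_{v*}^\top-n_{uv}\right|<\varepsilon\sqrt{n_{uu}n_{vv}}$$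 holds simultaneously for all $u,v\in V$. -/

import Mathlib

open MeasureTheory ProbabilityTheory Filter Matrix
open scoped NNReal

/-- The degree `d_u = ∑_w A_{uw}` of the node `u`, for a (possibly weighted) adjacency matrix with
nonnegative integer entries. -/
def nodeDegree {V : Type*} [Fintype V] (A : Matrix V V ℕ) (u : V) : ℕ :=
  ∑ w, A u w

/-- The 2-hop connectivity `n_{uv} = A_{u*} A_{v*}ᵀ`. -/
def twoHop {V : Type*} [Fintype V] (A : Matrix V V ℕ) (u v : V) : ℕ :=
  A u ⬝ᵥ A v

/-- `R` is a random `q × n` matrix (columns indexed by `V`) on the probability space `(Ω, μ)` whose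
entries are independent and normal with mean zero and variance `1 / q`. -/
structure IsGaussianProjection {V Ω : Type*} [MeasurableSpace Ω] {q : ℕ}
    (R : Ω → Matrix (Fin q) V ℝ) (μ : Measure Ω) : Prop where
  hasLaw : ∀ (i : Fin q) (w : V), HasLaw (fun ω => R ω i w) (gaussianReal 0 (1 / (q : ℝ≥0))) μ
  indep : iIndepFun (fun (p : Fin q × V) (ω : Ω) => R ω p.1 p.2) μ

/-- The embedding matrix `X = A Rᵀ`, whose row `X_{u*}` is the embedding of the node `u`. -/
def embedding {V : Type*} [Fintype V] {q : ℕ} (A : Matrix V V ℕ) (R : Matrix (Fin q) V ℝ) :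
    Matrix V (Fin q) ℝ :=
  A.map (Nat.cast : ℕ → ℝ) * Rᵀ

/-- `Y_q ~ᵃ N(m, s / q)`: the variables `(Y_q - m) / √s * √q` converge in distribution to the
standard normal law as `q → ∞`. The variables `Y_q` may live on different probability spaces. -/
def AsymptoticallyNormal {Ω : ℕ → Type*} [∀ q, MeasurableSpace (Ω q)] (μ : ∀ q, Measure (Ω q))
    [∀ q, IsProbabilityMeasure (μ q)] (Y : ∀ q, Ω q → ℝ) (m s : ℝ) : Prop :=
  TendstoInDistribution (fun q ω => (Y q ω - m) / √s * √(q : ℝ)) atTop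
    (id : ℝ → ℝ) μ (gaussianReal 0 1)

/-!
# Random projection of two-hop connectivities

The tail bound rests on an exponential bound for gamma tails with an explicit Gaussian-type prefactor
(Stirling's formula at half-integers bounds the tilted density), which is what lets a union bound
over all pairs of nodes, the diagonal included, fit into the stated projection dimension.
-/

/-! Scale the rows of `A` at `u` and `v` to unit vectors with inner product `ρ`, which lies in `[0,
1]`. Their sum and difference are orthogonal, so the Gaussian projections of these two vectors are
independent, with variances `(2 ± 2ρ)/q`. Polarisation (`embedding_dotProduct_sub`) turns the
centred dot product into a difference of two independent sums of `q` squares. Both parts start from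
there.

For (a), the difference is a sum of `q` i.i.d. centred terms whose variance comes from the Gaussian
fourth moment. `tendstoInDistribution_sum_centered_sq` compares characteristic functions, so the
probability spaces may change with `q`.

For (b), the deviation becomes a two-sided tail of `T - D`, with `T` gamma of shape `q/2` and `D`
distributed as `b = (1 - ρ)/(1 + ρ)` times an independent copy of `T`. Chernoff bounds give `exp
(-y)` per tail, `y = qε²/(4(1 + ε))`. With prefactor 1 this is too weak: the union bound runs over
`N(N+1)/2` unordered pairs, diagonal included, against a budget of `N(N-1)`. At `N = 2` the two
tails together may cost at most `(2/3) exp (-y)`.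

The saving comes from what Chernoff discards. After exponential tilting the tail is an integral of
`exp (-τ|t - x|)` against a gamma density. That density is bounded by its mode, which Stirling
controls, so its mass cannot concentrate at `x` and the integral stays well below 1
(`setIntegral_Ici_mul_exp_le`). Since `y ≥ log 2` always holds here, the resulting constants fit
(`measureReal_two_tails_le`). -/

/-! ### Stirling's bound and the mode of the gamma density. -/

/-- Log-convexity of the Gamma function between `a` and `a + 1`. -/
theorem Gamma_add_half_le {a : ℝ} (ha : 0 < a) :
    Real.Gamma (a + 1 / 2) ≤ √a * Real.Gamma a := by
  have h := Real.Gamma_mul_add_mul_le_rpow_Gamma_mul_rpow_Gamma ha (by positivity : 0 < a + 1)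
    (by norm_num : (0 : ℝ) < 1 / 2) (by norm_num : (0 : ℝ) < 1 / 2) (by norm_num)
  have hG := Real.Gamma_pos_of_pos ha
  rw [Real.Gamma_add_one ha.ne', Real.mul_rpow ha.le hG.le, ← Real.sqrt_eq_rpow,
    ← Real.sqrt_eq_rpow] at h
  calc Real.Gamma (a + 1 / 2) = Real.Gamma (1 / 2 * a + 1 / 2 * (a + 1)) := by ring_nf
    _ ≤ _ := h
    _ = √a * (√(Real.Gamma a) * √(Real.Gamma a)) := by ring
    _ = _ := by rw [Real.mul_self_sqrt hG.le]

/-- Stirling's lower bound for the Gamma function at half-integers. -/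
theorem stirling_le_Gamma_half_nat {m : ℕ} (hm : 0 < m) :
    √(2 * Real.pi / (m / 2 : ℝ)) * ((m / 2 : ℝ) / Real.exp 1) ^ (m / 2 : ℝ)
      ≤ Real.Gamma (m / 2 : ℝ) := by
  have hm0 : (0 : ℝ) < m := by exact_mod_cast hm
  set a : ℝ := m / 2 with ha
  have ha0 : 0 < a := by positivity
  have hG := Real.Gamma_pos_of_pos ha0
  -- Squared, the claim follows from the duplication formula: log-convexity bounds `Γ(a) Γ(a + 1/2)`
  -- by `√a Γ(a)²`, and `Γ(2a) = (m - 1)!` is bounded below by Stirling for factorials.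
  refine le_of_sq_le_sq ?_ hG.le
  have hdup := Real.Gamma_mul_Gamma_add_half a
  have h2a : 2 * a = m := by rw [ha]; ring
  obtain ⟨j, rfl⟩ : ∃ j, m = j + 1 := ⟨m - 1, by omega⟩
  have hst := Stirling.le_factorial_stirling (j + 1)
  rw [h2a] at hdup
  have hfac : Real.Gamma ((j + 1 : ℕ) : ℝ) = (j.factorial : ℝ) := by
    rw [Nat.cast_add, Nat.cast_one, Real.Gamma_nat_eq_factorial]
  rw [hfac] at hdup
  have hfs : ((j + 1).factorial : ℝ) = ((j + 1 : ℕ) : ℝ) * j.factorial := by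
    rw [Nat.factorial_succ, Nat.cast_mul]
  rw [hfs] at hst
  have hpow : (2 : ℝ) ^ (1 - ((j + 1 : ℕ) : ℝ)) = 2 * (2⁻¹) ^ (j + 1) := by
    rw [Real.rpow_sub (by norm_num), Real.rpow_one, Real.rpow_natCast, inv_pow]; rfl
  rw [hpow] at hdup
  have hup : j.factorial * (2 * (2⁻¹ : ℝ) ^ (j + 1)) * √Real.pi
      ≤ √a * Real.Gamma a ^ 2 := by
    rw [← hdup]
    calc _ ≤ Real.Gamma a * (√a * Real.Gamma a) :=
          mul_le_mul_of_nonneg_left (Gamma_add_half_le ha0) hG.le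
      _ = _ := by ring
  have hrp : ((a / Real.exp 1) ^ a) ^ 2 = (a / Real.exp 1) ^ (j + 1) := by
    rw [← Real.rpow_natCast, ← Real.rpow_natCast, ← Real.rpow_mul (by positivity), ← h2a]
    congr 1; push_cast; ring
  rw [mul_pow, Real.sq_sqrt (by positivity), hrp]
  rw [← h2a] at hst
  have hae : (2 * a / Real.exp 1) ^ (j + 1) * (2⁻¹) ^ (j + 1) = (a / Real.exp 1) ^ (j + 1) := by
    rw [← mul_pow]; congr 1; ring
  have hs4 : √(2 * Real.pi * (2 * a)) = 2 * √Real.pi * √a := by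
    rw [show 2 * Real.pi * (2 * a) = 2 ^ 2 * (Real.pi * a) by ring, Real.sqrt_mul (by positivity),
      Real.sqrt_sq (by norm_num), Real.sqrt_mul Real.pi_pos.le]; ring
  rw [hs4] at hst
  have hsa : 0 < √a := Real.sqrt_pos.2 ha0
  have hsa2 : √a * √a = a := Real.mul_self_sqrt ha0.le
  have hsp : √Real.pi * √Real.pi = Real.pi := Real.mul_self_sqrt Real.pi_pos.le
  refine le_of_mul_le_mul_left (le_trans ?_ hup) hsa
  have key := mul_le_mul_of_nonneg_right hst
    (by positivity : 0 ≤ (2⁻¹ : ℝ) ^ (j + 1) * √Real.pi / a)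
  calc √a * (2 * Real.pi / a * (a / Real.exp 1) ^ (j + 1))
      = 2 * √Real.pi * √a * (2 * a / Real.exp 1) ^ (j + 1)
          * ((2⁻¹ : ℝ) ^ (j + 1) * √Real.pi / a) := by
        rw [← hae]; linear_combination (-2 * √a / a * (2 * a / Real.exp 1) ^ (j + 1) *
          (2⁻¹ : ℝ) ^ (j + 1)) * hsp
    _ ≤ _ := key
    _ = _ := by field_simp

/-- The mode bound for the gamma density. -/
theorem gammaPDFReal_le {n r : ℝ} (hn : 0 < n) (hr : 0 < r)
    (hG : √(2 * Real.pi / n) * (n / Real.exp 1) ^ n ≤ Real.Gamma n) (t : ℝ) :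
    gammaPDFReal (n + 1) r t ≤ r / √(2 * Real.pi * n) := by
  unfold gammaPDFReal
  split_ifs with ht
  swap; · positivity
  have hGn : Real.Gamma (n + 1) = n * Real.Gamma n := Real.Gamma_add_one hn.ne'
  have hG1 : √(2 * Real.pi * n) * (n / Real.exp 1) ^ n ≤ Real.Gamma (n + 1) := by
    rw [hGn]
    calc _ = n * (√(2 * Real.pi / n) * (n / Real.exp 1) ^ n) := by
          rw [show 2 * Real.pi * n = n ^ 2 * (2 * Real.pi / n) by field_simp,
            Real.sqrt_mul (by positivity), Real.sqrt_sq hn.le]; ring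
      _ ≤ _ := by gcongr
  have hpos : 0 < √(2 * Real.pi * n) * (n / Real.exp 1) ^ n := by positivity
  have hs : (r * t) ^ n * Real.exp (-(r * t)) ≤ (n / Real.exp 1) ^ n := by
    have h1 : r * t / n ≤ Real.exp (r * t / n - 1) := by
      have := Real.add_one_le_exp (r * t / n - 1); linarith
    have h2 : r * t ≤ n / Real.exp 1 * Real.exp (r * t / n) := by
      rw [Real.exp_sub] at h1
      rw [div_le_iff₀ hn] at h1
      calc _ ≤ _ := h1
        _ = _ := by ring
    calc _ ≤ (n / Real.exp 1 * Real.exp (r * t / n)) ^ n * Real.exp (-(r * t)) := by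
          gcongr
      _ = (n / Real.exp 1) ^ n := by
          rw [Real.mul_rpow (by positivity) (by positivity), ← Real.exp_mul,
            div_mul_cancel₀ _ hn.ne', mul_assoc, ← Real.exp_add]
          simp
  have hrt : r ^ (n + 1) * t ^ (n + 1 - 1) = r * (r * t) ^ n := by
    rw [add_sub_cancel_right, Real.rpow_add hr, Real.rpow_one, Real.mul_rpow hr.le ht]; ring
  calc r ^ (n + 1) / Real.Gamma (n + 1) * t ^ (n + 1 - 1) * Real.exp (-(r * t))
      = r * ((r * t) ^ n * Real.exp (-(r * t))) / Real.Gamma (n + 1) := by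
        rw [div_mul_eq_mul_div, hrt]; ring
    _ ≤ r * (n / Real.exp 1) ^ n / (√(2 * Real.pi * n) * (n / Real.exp 1) ^ n) := by
        gcongr
    _ = _ := by field_simp

/-! ### Gamma tails by exponential tilting. -/

theorem setIntegral_exp_sub_exp {τ : ℝ} (hτ : 0 < τ) (x : ℝ) :
    ∫ t in x..(x + 3 / τ), (Real.exp (-(τ * (t - x))) - Real.exp (-3))
      = (1 - 4 * Real.exp (-3)) / τ := by
  have hd : ∀ t ∈ Set.uIcc x (x + 3 / τ), HasDerivAt
      (fun t => -(Real.exp (-(τ * (t - x))) / τ) - Real.exp (-3) * t)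
      (Real.exp (-(τ * (t - x))) - Real.exp (-3)) t := by
    intro t _
    have h1 : HasDerivAt (fun t => -(τ * (t - x))) (-τ) t := by
      have h0 := (((hasDerivAt_id t).sub_const x).const_mul τ).neg
      rw [mul_one] at h0
      exact h0
    have h2 := ((h1.exp.div_const τ).neg).sub ((hasDerivAt_id t).const_mul (Real.exp (-3)))
    convert! h2 using 1
    field_simp
  rw [intervalIntegral.integral_eq_sub_of_hasDerivAt hd
    (Continuous.intervalIntegrable (by fun_prop) _ _)]
  have : τ * (x + 3 / τ - x) = 3 := by field_simp; ring
  rw [this]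
  simp
  field_simp
  ring

/-- A function bounded by `M` with integral `1` has exponential moment, over a half-line, at most
that of the extremal arrangement. -/
theorem setIntegral_Ici_mul_exp_le {f : ℝ → ℝ} {M τ : ℝ} (hτ : 0 < τ) (hf0 : ∀ t, 0 ≤ f t)
    (hfM : ∀ t, f t ≤ M) (hfi : Integrable f) (hf1 : ∫ t, f t = 1) (x : ℝ) :
    ∫ t in Set.Ici x, f t * Real.exp (-(τ * (t - x)))
      ≤ (1 - 4 * Real.exp (-3)) * (M / τ) + Real.exp (-3) := by
  set c := Real.exp (-3) with hc
  have hc0 : 0 < c := Real.exp_pos _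
  set J : Set ℝ := Set.Ioc x (x + 3 / τ)
  set g : ℝ → ℝ := fun t => J.indicator (fun t => M * (Real.exp (-(τ * (t - x))) - c)) t with hg
  have hgi : Integrable g := by
    refine (integrable_indicator_iff measurableSet_Ioc).2 ?_
    exact (Continuous.integrableOn_Icc (by fun_prop)).mono_set Set.Ioc_subset_Icc_self
  have hgI : ∫ t, g t = (1 - 4 * c) * (M / τ) := by
    rw [hg, integral_indicator measurableSet_Ioc,
      ← intervalIntegral.integral_of_le (by simp; positivity),
      intervalIntegral.integral_const_mul, setIntegral_exp_sub_exp hτ]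
    ring
  -- The constant `c` acts as a multiplier for the constraint of total mass 1: `f * (exp - c)` is at
  -- most `M * (exp - c)` where the bracket is positive, and at most 0 elsewhere. The sign changes
  -- at `x + 3/τ`. Any cutoff would be valid; 3 is close to optimal when `M/τ` is near 1/3, the
  -- critical case later.
  have hpt : ∀ t, t ∈ Set.Ioi x → f t * Real.exp (-(τ * (t - x))) ≤ g t + c * f t := by
    intro t ht
    have ht' : x < t := ht
    by_cases hJ : t ∈ J
    · have h3 : c ≤ Real.exp (-(τ * (t - x))) := by
        rw [hc]; apply Real.exp_le_exp.2
        have : t - x ≤ 3 / τ := by linarith [hJ.2]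
        have := (le_div_iff₀ hτ).1 this
        linarith
      simp only [hg, Set.indicator_of_mem hJ]
      nlinarith [hfM t]
    · have h3 : Real.exp (-(τ * (t - x))) ≤ c := by
        rw [hc]; apply Real.exp_le_exp.2
        have : 3 / τ ≤ t - x := by
          by_contra h
          exact hJ ⟨ht', by linarith [not_le.1 h]⟩
        have := (div_le_iff₀ hτ).1 this
        linarith
      simp only [hg, Set.indicator_of_notMem hJ]
      nlinarith [hf0 t]
  have hM : 0 ≤ M := (hf0 0).trans (hfM 0)
  have hgf : Integrable (fun t => g t + c * f t) := hgi.add (hfi.const_mul c)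
  have hg0 : ∀ t, 0 ≤ g t := by
    intro t
    refine Set.indicator_nonneg (fun s hs => ?_) t
    have : s - x ≤ 3 / τ := by linarith [hs.2]
    have := (le_div_iff₀ hτ).1 this
    exact mul_nonneg hM (sub_nonneg.2 (Real.exp_le_exp.2 (by linarith)))
  calc ∫ t in Set.Ici x, f t * Real.exp (-(τ * (t - x)))
      = ∫ t in Set.Ioi x, f t * Real.exp (-(τ * (t - x))) := integral_Ici_eq_integral_Ioi
    _ ≤ ∫ t in Set.Ioi x, (g t + c * f t) := by
        refine integral_mono_of_nonneg (ae_of_all _ fun t => mul_nonneg (hf0 t) (Real.exp_pos _).le)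
          hgf.integrableOn ?_
        exact (ae_restrict_iff' measurableSet_Ioi).2 (ae_of_all _ hpt)
    _ ≤ ∫ t, (g t + c * f t) :=
        setIntegral_le_integral hgf
          (ae_of_all _ fun t => add_nonneg (hg0 t) (mul_nonneg hc0.le (hf0 t)))
    _ = _ := by rw [integral_add hgi (hfi.const_mul c), hgI, integral_const_mul, hf1, mul_one]

theorem setIntegral_Iic_mul_exp_le {f : ℝ → ℝ} {M τ : ℝ} (hτ : 0 < τ) (hf0 : ∀ t, 0 ≤ f t)
    (hfM : ∀ t, f t ≤ M) (hfi : Integrable f) (hf1 : ∫ t, f t = 1) (x : ℝ) :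
    ∫ t in Set.Iic x, f t * Real.exp (-(τ * (x - t)))
      ≤ (1 - 4 * Real.exp (-3)) * (M / τ) + Real.exp (-3) := by
  have h := setIntegral_Ici_mul_exp_le hτ (f := fun t => f (-t)) (fun t => hf0 _) (fun t => hfM _)
    hfi.comp_neg (by rw [integral_neg_eq_self f volume]; exact hf1) (-x)
  refine le_of_eq_of_le ?_ h
  rw [integral_Ici_eq_integral_Ioi, ← integral_comp_neg_Iic x
    (fun t => f (-t) * Real.exp (-(τ * (t - -x))))]
  refine integral_congr_ae (ae_of_all _ fun t => ?_)
  simp only [neg_neg]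
  congr 2; ring

theorem integrable_gammaPDFReal {a r : ℝ} (ha : 0 < a) (hr : 0 < r) :
    Integrable (gammaPDFReal a r) := by
  refine ⟨(measurable_gammaPDFReal a r).aestronglyMeasurable, ?_⟩
  rw [hasFiniteIntegral_iff_ofReal (ae_of_all _ (gammaPDFReal_nonneg ha hr))]
  have := lintegral_gammaPDF_eq_one ha hr
  simp only [gammaPDF] at this
  rw [this]; exact ENNReal.one_lt_top

theorem integral_gammaPDFReal {a r : ℝ} (ha : 0 < a) (hr : 0 < r) :
    ∫ t, gammaPDFReal a r t = 1 := by
  rw [integral_eq_lintegral_of_nonneg_ae (ae_of_all _ (gammaPDFReal_nonneg ha hr))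
    (measurable_gammaPDFReal a r).aestronglyMeasurable]
  have := lintegral_gammaPDF_eq_one ha hr
  simp only [gammaPDF] at this
  rw [this]; simp

/-- Exponential tilting: changing the rate of a gamma density multiplies it by an exponential and a
constant. -/
theorem gammaPDFReal_one_eq {a r : ℝ} (hr : 0 < r) (t : ℝ) :
    gammaPDFReal a 1 t = r ^ (-a) * (gammaPDFReal a r t * Real.exp (-((1 - r) * t))) := by
  unfold gammaPDFReal
  split_ifs
  · rw [Real.one_rpow, Real.rpow_neg hr.le]
    have h : Real.exp (-(1 * t)) = Real.exp (-(r * t)) * Real.exp (-((1 - r) * t)) := by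
      rw [← Real.exp_add]; congr 1; ring
    rw [h]
    have := (Real.rpow_pos_of_pos hr a).ne'
    field_simp
  · simp

theorem gammaMeasure_real_eq {a : ℝ} (ha : 0 < a) {s : Set ℝ} (hs : MeasurableSet s) :
    (gammaMeasure a 1).real s = ∫ t in s, gammaPDFReal a 1 t := by
  rw [measureReal_def, gammaMeasure, withDensity_apply _ hs,
    integral_eq_lintegral_of_nonneg_ae (ae_of_all _ (gammaPDFReal_nonneg ha one_pos))
    (measurable_gammaPDFReal a 1).aestronglyMeasurable]
  rfl

/-- Sharpened Chernoff bound for the upper tail of a gamma distribution. -/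
theorem gammaMeasure_real_Ici_le {n τ : ℝ} (hn : 0 < n) (hτ : 0 < τ) (hτ1 : τ < 1)
    (hG : √(2 * Real.pi / n) * (n / Real.exp 1) ^ n ≤ Real.Gamma n) (x : ℝ) :
    (gammaMeasure (n + 1) 1).real (Set.Ici x) ≤
      (1 - τ) ^ (-(n + 1)) * ((1 - 4 * Real.exp (-3)) * ((1 - τ) / √(2 * Real.pi * n) / τ)
        + Real.exp (-3)) * Real.exp (-(τ * x)) := by
  have hr : 0 < 1 - τ := by linarith
  have ha : 0 < n + 1 := by linarith
  have h := setIntegral_Ici_mul_exp_le hτ (gammaPDFReal_nonneg ha hr) (gammaPDFReal_le hn hr hG)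
    (integrable_gammaPDFReal ha hr) (integral_gammaPDFReal ha hr) x
  have he : ∀ t, gammaPDFReal (n + 1) 1 t = (1 - τ) ^ (-(n + 1)) * Real.exp (-(τ * x)) *
      (gammaPDFReal (n + 1) (1 - τ) t * Real.exp (-(τ * (t - x)))) := by
    intro t
    rw [gammaPDFReal_one_eq hr]
    have : Real.exp (-((1 - (1 - τ)) * t)) = Real.exp (-(τ * x)) * Real.exp (-(τ * (t - x))) := by
      rw [← Real.exp_add]; congr 1; ring
    rw [this]; ring
  rw [gammaMeasure_real_eq ha measurableSet_Ici]
  simp_rw [he]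
  rw [integral_const_mul]
  calc _ ≤ (1 - τ) ^ (-(n + 1)) * Real.exp (-(τ * x)) * _ :=
        mul_le_mul_of_nonneg_left h (by positivity)
    _ = _ := by ring

/-- Sharpened Chernoff bound for the lower tail of a gamma distribution. -/
theorem gammaMeasure_real_Iic_le {n τ : ℝ} (hn : 0 < n) (hτ : 0 < τ)
    (hG : √(2 * Real.pi / n) * (n / Real.exp 1) ^ n ≤ Real.Gamma n) (x : ℝ) :
    (gammaMeasure (n + 1) 1).real (Set.Iic x) ≤
      (1 + τ) ^ (-(n + 1)) * ((1 - 4 * Real.exp (-3)) * ((1 + τ) / √(2 * Real.pi * n) / τ)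
        + Real.exp (-3)) * Real.exp (τ * x) := by
  have hr : 0 < 1 + τ := by linarith
  have ha : 0 < n + 1 := by linarith
  have h := setIntegral_Iic_mul_exp_le hτ (gammaPDFReal_nonneg ha hr) (gammaPDFReal_le hn hr hG)
    (integrable_gammaPDFReal ha hr) (integral_gammaPDFReal ha hr) x
  have he : ∀ t, gammaPDFReal (n + 1) 1 t = (1 + τ) ^ (-(n + 1)) * Real.exp (τ * x) *
      (gammaPDFReal (n + 1) (1 + τ) t * Real.exp (-(τ * (x - t)))) := by
    intro t
    rw [gammaPDFReal_one_eq hr]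
    have : Real.exp (-((1 - (1 + τ)) * t)) = Real.exp (τ * x) * Real.exp (-(τ * (x - t))) := by
      rw [← Real.exp_add]; congr 1; ring
    rw [this]; ring
  rw [gammaMeasure_real_eq ha measurableSet_Iic]
  simp_rw [he]
  rw [integral_const_mul]
  calc _ ≤ (1 + τ) ^ (-(n + 1)) * Real.exp (τ * x) * _ :=
        mul_le_mul_of_nonneg_left h (by positivity)
    _ = _ := by ring

/-! ### Moment generating functions and the gamma law of a sum of squares. -/

/-- No restriction on `t` is needed: where the integral diverges, both sides take the default value
0. Variance zero is allowed too, which is needed for parallel rows. -/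
theorem mgf_sq_gaussianReal (v : ℝ≥0) (t : ℝ) :
    mgf (fun x : ℝ => x ^ 2) (gaussianReal 0 v) t = (√(1 - 2 * v * t))⁻¹ := by
  rcases eq_or_ne v 0 with rfl | hv
  · simp [mgf, gaussianReal_zero_var]
  have hv0 : (0 : ℝ) < v := by exact_mod_cast pos_iff_ne_zero.2 hv
  unfold mgf
  rw [integral_gaussianReal_eq_integral_smul hv]
  have h : ∀ x : ℝ, gaussianPDFReal 0 v x • Real.exp (t * x ^ 2) =
      (√(2 * Real.pi * v))⁻¹ * Real.exp (-(1 / (2 * v) - t) * x ^ 2) := by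
    intro x
    rw [gaussianPDFReal_def, smul_eq_mul, mul_assoc, ← Real.exp_add]
    congr 2
    field_simp
    ring
  simp_rw [h]
  rw [integral_const_mul, integral_gaussian, mul_comm, ← div_eq_mul_inv,
    ← Real.sqrt_div' _ (by positivity), ← Real.sqrt_inv]
  congr 1
  have : 1 / (2 * (v : ℝ)) - t = (1 - 2 * v * t) / (2 * v) := by field_simp
  rw [this]
  rcases eq_or_ne (1 - 2 * v * t) 0 with h0 | h0
  · simp [h0]
  · field_simp

theorem mgf_id_gammaMeasure {a t : ℝ} (ha : 0 < a) (ht : t < 1) :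
    mgf id (gammaMeasure a 1) t = (1 - t) ^ (-a) := by
  have hr : 0 < 1 - t := by linarith
  unfold mgf gammaMeasure
  have hm : Measurable (gammaPDF a 1) := (measurable_gammaPDFReal a 1).ennreal_ofReal
  rw [integral_withDensity_eq_integral_toReal_smul hm
    (ae_of_all _ fun _ => ENNReal.ofReal_lt_top)]
  have h : ∀ x, (gammaPDF a 1 x).toReal • Real.exp (t * id x) =
      (1 - t) ^ (-a) * gammaPDFReal a (1 - t) x := by
    intro x
    rw [gammaPDF, ENNReal.toReal_ofReal (gammaPDFReal_nonneg ha one_pos x),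
      gammaPDFReal_one_eq hr, smul_eq_mul, mul_assoc, mul_assoc, ← Real.exp_add]
    have : -((1 - (1 - t)) * x) + t * id x = 0 := by simp
    rw [this]; simp
  simp_rw [h]
  rw [integral_const_mul, integral_gammaPDFReal ha hr, mul_one]

/-- The integrand dominates a multiple of `x ^ (a - 1)` on the positive half-line, so it is not
integrable and the integral defaults to 0. -/
theorem mgf_id_gammaMeasure_of_one_le {a t : ℝ} (ha : 0 < a) (ht : 1 ≤ t) :
    mgf id (gammaMeasure a 1) t = 0 := by
  unfold mgf gammaMeasure
  have hm : Measurable (gammaPDF a 1) := (measurable_gammaPDFReal a 1).ennreal_ofReal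
  rw [integral_withDensity_eq_integral_toReal_smul hm
    (ae_of_all _ fun _ => ENNReal.ofReal_lt_top)]
  refine integral_undef fun hi => not_integrableOn_Ioi_rpow (a - 1) ?_
  have hG := Real.Gamma_pos_of_pos ha
  refine Integrable.mono' ((hi.const_mul (Real.Gamma a)).integrableOn (s := Set.Ioi 0))
    (measurable_id.pow_const _).aestronglyMeasurable ?_
  refine (ae_restrict_iff' measurableSet_Ioi).2 (ae_of_all _ fun x hx => ?_)
  have hx0 : (0 : ℝ) < x := hx
  have hp : 0 < x ^ (a - 1) := Real.rpow_pos_of_pos hx0 _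
  rw [gammaPDF, ENNReal.toReal_ofReal (gammaPDFReal_nonneg ha one_pos x), gammaPDFReal,
    if_pos hx0.le, Real.norm_of_nonneg hp.le, Real.one_rpow, smul_eq_mul]
  have he : 1 ≤ Real.exp (-(1 * x)) * Real.exp (t * id x) := by
    rw [← Real.exp_add]; apply Real.one_le_exp
    simp only [id]; nlinarith
  calc x ^ (a - 1) = x ^ (a - 1) * 1 := (mul_one _).symm
    _ ≤ x ^ (a - 1) * (Real.exp (-(1 * x)) * Real.exp (t * id x)) := by gcongr
    _ = _ := by field_simp

/-- Two laws on the line whose moment-generating functions agree, and do not vanish near zero, are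
equal. -/
theorem MeasureTheory.Measure.ext_of_mgf_eq {μ ν : Measure ℝ} [IsProbabilityMeasure μ]
    [IsProbabilityMeasure ν] (h : mgf id μ = mgf id ν)
    (h0 : ∀ t ∈ Set.Ioo (-1 : ℝ) 1, mgf id μ t ≠ 0) : μ = ν := by
  have hint : (0 : ℝ) ∈ interior (integrableExpSet id μ) := by
    refine mem_interior.2 ⟨Set.Ioo (-1) 1, fun t ht => ?_, isOpen_Ioo, by norm_num⟩
    -- A divergent integral would make the moment generating function 0, so nonvanishing already
    -- yields integrability.
    by_contra hn
    exact h0 t ht (integral_undef hn)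
  refine Measure.ext_of_charFun (funext fun t => ?_)
  rw [← complexMGF_id_mul_I, ← complexMGF_id_mul_I]
  exact eqOn_complexMGF_of_mgf h (by simpa using hint)

theorem mgf_sum_sq {Ω ι : Type*} [Fintype ι] [MeasurableSpace Ω] {μ : Measure Ω}
    {Y : ι → Ω → ℝ} {v : ℝ≥0} (hY : ∀ i, HasLaw (Y i) (gaussianReal 0 v) μ)
    (hi : iIndepFun Y μ) (c t : ℝ) :
    mgf (fun ω => c * ∑ i, Y i ω ^ 2) μ t = ((√(1 - 2 * v * (c * t)))⁻¹) ^ Fintype.card ι := by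
  have hi2 : iIndepFun (fun i ω => Y i ω ^ 2) μ := hi.comp (fun _ x => x ^ 2) (by fun_prop)
  have h1 : mgf (fun ω => c * ∑ i, Y i ω ^ 2) μ t
      = mgf (∑ i, fun ω => Y i ω ^ 2) μ (c * t) := by
    unfold mgf
    congr 1; ext ω
    simp only [Finset.sum_apply]
    congr 1; ring
  rw [h1, hi2.mgf_sum₀ (fun i => (hY i).aemeasurable.pow_const 2)]
  have h2 : ∀ i, mgf (fun ω => Y i ω ^ 2) μ (c * t) = (√(1 - 2 * v * (c * t)))⁻¹ := by
    intro i
    rw [← mgf_sq_gaussianReal, ← (hY i).map_eq, mgf_map (hY i).aemeasurable (by fun_prop)]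
    rfl
  simp [h2]

/-- Half a sum of squares of independent standard normal variables has a gamma law. -/
theorem hasLaw_gammaMeasure_sum_sq {Ω ι : Type*} [Fintype ι] [Nonempty ι] [MeasurableSpace Ω]
    {μ : Measure Ω} [IsProbabilityMeasure μ] {Y : ι → Ω → ℝ} {v : ℝ≥0} (hv : v ≠ 0)
    (hY : ∀ i, HasLaw (Y i) (gaussianReal 0 v) μ) (hi : iIndepFun Y μ) :
    HasLaw (fun ω => (1 / (2 * v : ℝ)) * ∑ i, Y i ω ^ 2)
      (gammaMeasure (Fintype.card ι / 2 : ℝ) 1) μ := by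
  have hv0 : (0 : ℝ) < v := by exact_mod_cast pos_iff_ne_zero.2 hv
  have hc : (0 : ℝ) < Fintype.card ι / 2 := by
    have := Fintype.card_pos (α := ι); positivity
  have hm : AEMeasurable (fun ω => (1 / (2 * v : ℝ)) * ∑ i, Y i ω ^ 2) μ :=
    (Finset.aemeasurable_fun_sum _ fun i _ => (hY i).aemeasurable.pow_const 2).const_mul _
  refine ⟨hm, ?_⟩
  have : IsProbabilityMeasure (gammaMeasure (Fintype.card ι / 2 : ℝ) 1) :=
    isProbabilityMeasure_gammaMeasure hc one_pos
  have := Measure.isProbabilityMeasure_map (μ := μ) hm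
  have key : mgf id (gammaMeasure (Fintype.card ι / 2 : ℝ) 1) =
      mgf id (μ.map (fun ω => (1 / (2 * v : ℝ)) * ∑ i, Y i ω ^ 2)) := by
    ext t
    rw [mgf_id_map hm, mgf_sum_sq hY hi]
    have h1 : 1 - 2 * (v : ℝ) * (1 / (2 * v) * t) = 1 - t := by field_simp
    rw [h1]
    rcases lt_or_ge t 1 with ht | ht
    · rw [mgf_id_gammaMeasure hc ht, Real.sqrt_eq_rpow, ← Real.rpow_neg (by linarith),
        ← Real.rpow_natCast, ← Real.rpow_mul (by linarith)]
      congr 1; ring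
    -- Beyond the abscissa of convergence both sides are default zeros; the power of 0 vanishes
    -- because the index type is nonempty.
    · rw [mgf_id_gammaMeasure_of_one_le hc ht, Real.sqrt_eq_zero_of_nonpos (by linarith)]
      simp
  refine (Measure.ext_of_mgf_eq key fun t ht => ?_).symm
  rw [mgf_id_gammaMeasure hc ht.2]
  exact (Real.rpow_pos_of_pos (by linarith [ht.2]) _).ne'

/-! ### Tails of the difference `T - D`: exponents and constants. -/

/-- Integrating out an independent variable in an exponential tail bound. -/
theorem IndepFun.measureReal_le_mul_mgf {Ω : Type*} [MeasurableSpace Ω] {μ : Measure Ω}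
    [IsProbabilityMeasure μ] {T D : Ω → ℝ} {ν : Measure ℝ} (hT : HasLaw T ν μ)
    (hD : AEMeasurable D μ) (hTD : IndepFun D T μ) {s : ℝ → Set ℝ}
    (hs : MeasurableSet {p : ℝ × ℝ | p.2 ∈ s p.1}) {C θ : ℝ}
    (hb : ∀ d, ν.real (s d) ≤ C * Real.exp (θ * d))
    (hint : Integrable (fun ω => Real.exp (θ * D ω)) μ) :
    μ.real {ω | T ω ∈ s (D ω)} ≤ C * mgf D μ θ := by
  have : IsProbabilityMeasure ν := hT.map_eq ▸ Measure.isProbabilityMeasure_map hT.aemeasurable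
  have hC : 0 ≤ C := by
    have := measureReal_nonneg.trans (hb 0); simpa using this
  have hpr := (indepFun_iff_map_prod_eq_prod_map_map hD hT.aemeasurable).1 hTD
  rw [hT.map_eq] at hpr
  have h1 : μ {ω | T ω ∈ s (D ω)} = ((μ.map D).prod ν) {p : ℝ × ℝ | p.2 ∈ s p.1} := by
    rw [← hpr, Measure.map_apply_of_aemeasurable (hD.prodMk hT.aemeasurable) hs]
    rfl
  have h2 : μ {ω | T ω ∈ s (D ω)} ≤ ENNReal.ofReal (C * mgf D μ θ) := by
    rw [h1, Measure.prod_apply hs]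
    calc ∫⁻ d, ν (Prod.mk d ⁻¹' {p : ℝ × ℝ | p.2 ∈ s p.1}) ∂(μ.map D)
        ≤ ∫⁻ d, ENNReal.ofReal (C * Real.exp (θ * d)) ∂(μ.map D) := by
          refine lintegral_mono fun d => ?_
          rw [ENNReal.le_ofReal_iff_toReal_le (measure_ne_top _ _) (by positivity)]
          exact hb d
      _ = ∫⁻ ω, ENNReal.ofReal (C * Real.exp (θ * D ω)) ∂μ :=
          lintegral_map' (by fun_prop) hD
      _ = ENNReal.ofReal (∫ ω, C * Real.exp (θ * D ω) ∂μ) :=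
          (ofReal_integral_eq_lintegral_ofReal (hint.const_mul C)
            (ae_of_all _ fun ω => by positivity)).symm
      _ = _ := by rw [integral_const_mul]; rfl
  rw [measureReal_def]
  refine ENNReal.toReal_le_of_le_ofReal ?_ h2
  exact mul_nonneg hC (mgf_nonneg)

/-- This is `s ≤ sinh s` at `s = log (1 + x)`. -/
theorem Real.log_one_add_le_mul_div {x : ℝ} (hx : 0 ≤ x) :
    Real.log (1 + x) ≤ x * (x + 2) / (2 * (1 + x)) := by
  have h1 : 0 < 1 + x := by linarith
  have h := Real.self_le_sinh_iff.2 (Real.log_nonneg (by linarith : 1 ≤ 1 + x))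
  rw [Real.sinh_log h1] at h
  refine h.trans_eq ?_
  field_simp
  ring

theorem rational_factor_le_of_add_le_one {e b : ℝ} (he0 : 0 ≤ e) (hb0 : 0 ≤ b)
    (hb1 : b ≤ 1) (hs : e + e * b ≤ 1) :
    1 + e + e * b ≤ 1.08 * (1 + 0.69 *
      (2 * (1 + e) / (1 + e * b) * (0.5 + b - b ^ 2 / 2 + (2 * (e * b) + e) / 10) - 1)) := by
  have hx : 0 ≤ e * b := by positivity
  rw [div_mul_eq_mul_div, ← sub_nonneg]
  have h1 : 0 < 1 + e * b := by positivity
  have : 0 ≤ (1.08 * ((1 - 0.69) * (1 + e * b) + 0.69 *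
      (2 * (1 + e) * (0.5 + b - b ^ 2 / 2 + (2 * (e * b) + e) / 10)))
      - (1 + e + e * b) * (1 + e * b)) := by
    nlinarith [mul_nonneg hx he0, mul_nonneg hb0 (sub_nonneg.2 hb1), mul_nonneg hx
      (sub_nonneg.2 hb1), mul_nonneg hx (sub_nonneg.2 hs), mul_nonneg he0 (sub_nonneg.2 hs),
      mul_nonneg hb0 (sub_nonneg.2 hs),sq_nonneg (e - 0.35)]
  calc (0:ℝ) ≤ _ / (1 + e * b) := div_nonneg this h1.le
    _ = _ := by field_simp; ring

theorem rational_factor_le_of_one_le_add {e b : ℝ} (he0 : 0 ≤ e) (he1 : e ≤ 1) (hb0 : 0 ≤ b)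
    (hb1 : b ≤ 1) (hs : 1 ≤ e + e * b) :
    1 + e + e * b ≤ 1.08 * (2.718 * (0.69 *
      (2 * (1 + e) / (1 + e * b) * (0.5 + b - b ^ 2 / 2 + (2 * (e * b) + e) / 10) - 1))) := by
  have hx : 0 ≤ e * b := by positivity
  rw [div_mul_eq_mul_div, ← sub_nonneg]
  have h1 : 0 < 1 + e * b := by positivity
  have : 0 ≤ (1.08 * (2.718 * (0.69 *
      (2 * (1 + e) * (0.5 + b - b ^ 2 / 2 + (2 * (e * b) + e) / 10) - (1 + e * b))))
      - (1 + e + e * b) * (1 + e * b)) := by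
    nlinarith [mul_nonneg hx he0, mul_nonneg hb0 (sub_nonneg.2 hb1), mul_nonneg hx
      (sub_nonneg.2 hb1), mul_nonneg hx (sub_nonneg.2 hs), mul_nonneg he0 (sub_nonneg.2 hs),
      mul_nonneg hb0 (sub_nonneg.2 hs),mul_nonneg he0 (sub_nonneg.2 he1),  mul_nonneg
      (mul_nonneg hx (sub_nonneg.2 hb1)) (sub_nonneg.2 he1)]
  calc (0:ℝ) ≤ _ / (1 + e * b) := div_nonneg this h1.le
    _ = _ := by field_simp

/-- In the lower tail the prefactor grows by `1 + e + e * b`, but the exponent improves from `y` to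
`y * W` with `W ≥ 1`. As `y ≥ 0.69`, the surplus `exp (-0.69 (W - 1))` absorbs this growth up to
1.08. With `z = 0.69 (W - 1)`, the tangent `1 + z ≤ exp z` suffices while `e + e * b ≤ 1`, and the
tangent through the origin, `exp 1 * z ≤ exp z`, beyond. -/
theorem rational_factor_mul_exp_le {e b y : ℝ} (he0 : 0 ≤ e) (he1 : e ≤ 1) (hb0 : 0 ≤ b)
    (hb1 : b ≤ 1) (hy : 0.69 ≤ y) :
    (1 + e + e * b) * Real.exp (-(y * (2 * (1 + e) / (1 + e * b) *
      (0.5 + b - b ^ 2 / 2 + (2 * (e * b) + e) / 10)))) ≤ 1.08 * Real.exp (-y) ∧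
    Real.exp (-(y * (2 * (1 + e) / (1 + e * b) *
      (0.5 + b - b ^ 2 / 2 + (2 * (e * b) + e) / 10)))) ≤ Real.exp (-y) := by
  have hx : 0 ≤ e * b := by positivity
  have h1 : 0 < 1 + e * b := by positivity
  have hZ0 : 1 ≤ 2 * (1 + e) / (1 + e * b) *
      (0.5 + b - b ^ 2 / 2 + (2 * (e * b) + e) / 10) := by
    rw [div_mul_eq_mul_div, le_div_iff₀ h1]
    nlinarith [mul_nonneg hb0 (sub_nonneg.2 hb1), mul_nonneg hx (sub_nonneg.2 hb1),
      mul_nonneg he0 (sub_nonneg.2 he1)]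
  have hcase : 1 + e + e * b ≤ 1.08 * Real.exp (0.69 * (2 * (1 + e) / (1 + e * b) *
      (0.5 + b - b ^ 2 / 2 + (2 * (e * b) + e) / 10) - 1)) := by
    rcases le_total (e + e * b) 1 with hs | hs
    · refine (rational_factor_le_of_add_le_one he0 hb0 hb1 hs).trans ?_
      gcongr
      rw [add_comm]
      exact Real.add_one_le_exp _
    · refine (rational_factor_le_of_one_le_add he0 he1 hb0 hb1 hs).trans ?_
      gcongr
      set z := 0.69 * (2 * (1 + e) / (1 + e * b) *
        (0.5 + b - b ^ 2 / 2 + (2 * (e * b) + e) / 10) - 1) with hz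
      have hz0 : 0 ≤ z := by rw [hz]; exact mul_nonneg (by norm_num) (by linarith)
      have h2 : z ≤ Real.exp (z - 1) := by have := Real.add_one_le_exp (z - 1); linarith
      calc 2.718 * z ≤ Real.exp 1 * Real.exp (z - 1) := by
            gcongr
            have := Real.exp_one_gt_d9; norm_num at this ⊢; linarith
        _ = Real.exp z := by rw [← Real.exp_add]; congr 1; ring
  generalize 2 * (1 + e) / (1 + e * b) *
      (0.5 + b - b ^ 2 / 2 + (2 * (e * b) + e) / 10) = W at *
  have hyW : Real.exp (-(y * W)) ≤ Real.exp (-y) * Real.exp (-(0.69 * (W - 1))) := by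
    rw [← Real.exp_add]; apply Real.exp_le_exp.2; nlinarith
  constructor
  · calc _ ≤ 1.08 * Real.exp (0.69 * (W - 1)) *
          (Real.exp (-y) * Real.exp (-(0.69 * (W - 1)))) := by gcongr
      _ = 1.08 * Real.exp (-y) * (Real.exp (0.69 * (W - 1)) * Real.exp (-(0.69 * (W - 1)))) := by
        ring
      _ = _ := by rw [← Real.exp_add]; simp
  · apply Real.exp_le_exp.2; nlinarith

theorem upper_exponent_le {k e b : ℝ} (hk : 0 ≤ k) (he0 : 0 < e) (hb0 : 0 ≤ b) (hb1 : b ≤ 1) :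
    (1 - e / (1 + e)) ^ (-k) * Real.exp (-(e / (1 + e) * (k * (1 - b) + k * e * (1 + b)))) *
      (1 + b * (e / (1 + e))) ^ (-k) ≤ Real.exp (-(k * e ^ 2 / (2 * (1 + e)))) := by
  have h1 : 0 < 1 + e := by linarith
  have ha : 1 - e / (1 + e) = (1 + e)⁻¹ := by field_simp; ring
  have hv : 0 ≤ b * (e / (1 + e)) := by positivity
  rw [ha, Real.rpow_def_of_pos (by positivity), Real.rpow_def_of_pos (by linarith),
    ← Real.exp_add, ← Real.exp_add, Real.log_inv]
  apply Real.exp_le_exp.2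
  have hl1 := Real.log_one_add_le_mul_div he0.le
  have hl2 := Real.le_log_one_add_of_nonneg hv
  set v := b * (e / (1 + e)) with hvd
  have hl3 : v - v ^ 2 / 2 ≤ Real.log (1 + v) := by
    refine le_trans ?_ hl2
    rw [le_div_iff₀ (by linarith)]; nlinarith [pow_nonneg hv 3]
  have hmain : e * (e + 2) / (2 * (1 + e)) - e / (1 + e) * (1 - b + e * (1 + b)) - (v - v ^ 2 / 2)
      ≤ -(e ^ 2 / (2 * (1 + e))) := by
    -- The slack vanishes at `b = 0`, so parallel rows, in particular `u = v`, are the tight case of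
    -- this estimate.
    have : e * (e + 2) / (2 * (1 + e)) - e / (1 + e) * (1 - b + e * (1 + b)) - (v - v ^ 2 / 2)
      + e ^ 2 / (2 * (1 + e)) = -(e ^ 2 * b * (2 * (1 + e) - b) / (2 * (1 + e) ^ 2)) := by
      rw [hvd]; field_simp; ring
    have h2 : 0 ≤ e ^ 2 * b * (2 * (1 + e) - b) / (2 * (1 + e) ^ 2) := by
      have : 0 ≤ 2 * (1 + e) - b := by linarith
      positivity
    linarith
  calc _ = k * (Real.log (1 + e) - e / (1 + e) * (1 - b + e * (1 + b)) - Real.log (1 + v)) := by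
        ring
    _ ≤ k * -(e ^ 2 / (2 * (1 + e))) := by
        apply mul_le_mul_of_nonneg_left _ hk; linarith
    _ = _ := by ring

theorem lower_exponent_le {k e b : ℝ} (hk : 0 ≤ k) (he0 : 0 < e) (he1 : e ≤ 1) (hb0 : 0 ≤ b)
    (hb1 : b ≤ 1) :
    (1 + e / (1 + e * b)) ^ (-k) *
        Real.exp (e / (1 + e * b) * (k * (1 - b) - k * e * (1 + b))) *
        (1 - b * (e / (1 + e * b))) ^ (-k) ≤
      Real.exp (-(k * e ^ 2 / (2 * (1 + e)) * (2 * (1 + e) / (1 + e * b) *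
        (0.5 + b - b ^ 2 / 2 + (2 * (e * b) + e) / 10)))) := by
  have hx : 0 ≤ e * b := by positivity
  have h1 : 0 < 1 + e * b := by linarith
  have ha : 1 - b * (e / (1 + e * b)) = (1 + e * b)⁻¹ := by field_simp; ring
  have hv : 0 ≤ e / (1 + e * b) := by positivity
  rw [ha, Real.rpow_def_of_pos (by linarith), Real.rpow_def_of_pos (by positivity),
    ← Real.exp_add, ← Real.exp_add, Real.log_inv]
  apply Real.exp_le_exp.2
  have hl1 := Real.log_one_add_le_mul_div hx
  have hl2 := Real.le_log_one_add_of_nonneg hv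
  have hu : 0 < 2 * (e * b) + e + 2 := by positivity
  have hl3 : 2 * (e / (1 + e * b)) / (e / (1 + e * b) + 2) = 2 * e / (2 * (e * b) + e + 2) := by
    field_simp; ring
  rw [hl3] at hl2
  -- With `s = 2 * (e * b) + e`, the convex function `1 / (s + 2)` lies below its chord over `[0,
  -- 3]`.
  have hchord : 1 / (2 * (e * b) + e + 2) ≤ 1 / 2 - (2 * (e * b) + e) / 10 := by
    rw [div_le_iff₀ hu]
    have h0 : 0 ≤ 2 * (e * b) + e := by positivity
    have h3 : 2 * (e * b) + e ≤ 3 := by nlinarith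
    nlinarith [mul_nonneg h0 (sub_nonneg.2 h3)]
  have hid : e * b * (e * b + 2) / (2 * (1 + e * b)) + e / (1 + e * b) * (1 - b - e * (1 + b))
      - 2 * e / (2 * (e * b) + e + 2) = -(e ^ 2 / (1 + e * b) *
        (1 + b - b ^ 2 / 2 - 1 / (2 * (e * b) + e + 2))) := by
    field_simp; ring
  have hm : e ^ 2 / (1 + e * b) * (0.5 + b - b ^ 2 / 2 + (2 * (e * b) + e) / 10) ≤
      e ^ 2 / (1 + e * b) * (1 + b - b ^ 2 / 2 - 1 / (2 * (e * b) + e + 2)) := by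
    apply mul_le_mul_of_nonneg_left _ (by positivity)
    linarith
  calc _ = k * (Real.log (1 + e * b) + e / (1 + e * b) * (1 - b - e * (1 + b))
        - Real.log (1 + e / (1 + e * b))) := by ring
    _ ≤ k * -(e ^ 2 / (1 + e * b) * (0.5 + b - b ^ 2 / 2 + (2 * (e * b) + e) / 10)) := by
        apply mul_le_mul_of_nonneg_left _ hk; linarith
    _ = _ := by field_simp

theorem exp_neg_three_bounds : 0.0487 ≤ Real.exp (-3) ∧ Real.exp (-3) ≤ 1 / 4 := by
  have h1 := Real.exp_neg_one_gt_d9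
  have h2 := Real.exp_neg_one_lt_d9
  have h : Real.exp (-3) = Real.exp (-1) ^ 3 := by
    rw [← Real.exp_nat_mul]; norm_num
  rw [h]
  constructor
  · calc (0.0487 : ℝ) ≤ 0.36787944116 ^ 3 := by norm_num
      _ ≤ _ := by gcongr
  · calc Real.exp (-1) ^ 3 ≤ 0.3678794412 ^ 3 := by gcongr
      _ ≤ _ := by norm_num

/-- The left side is `1 / √(2π n e²)`, and `y ≥ 0.6931`, just below `log 2`, forces `n e² ≥ 2 *
0.6931`. -/
theorem inv_sqrt_le_of_log_two_le {n e y : ℝ} (he0 : 0 < e) (he1 : e ≤ 1)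
    (hy : y = (n + 1) * e ^ 2 / (2 * (1 + e))) (hy2 : 0.6931 ≤ y) (hn : 0 < n) :
    1 / √(2 * Real.pi * n) / e ≤ 0.339 := by
  have h1 : 0 < 1 + e := by linarith
  have hs : 0 < √(2 * Real.pi * n) := by have := Real.pi_pos; positivity
  have hne : n * e ^ 2 = 2 * y * (1 + e) - e ^ 2 := by rw [hy]; field_simp; ring
  have hlow : 1.3862 ≤ n * e ^ 2 := by rw [hne]; nlinarith
  have hsq : (1 / 0.339 : ℝ) ≤ √(2 * Real.pi * n) * e := by
    refine le_of_sq_le_sq ?_ (by positivity)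
    rw [mul_pow, Real.sq_sqrt (by have := Real.pi_pos; positivity)]
    have := Real.pi_gt_d4
    calc ((1 / 0.339 : ℝ)) ^ 2 ≤ 2 * 3.1415 * 1.3862 := by norm_num
      _ ≤ 2 * Real.pi * (n * e ^ 2) := by gcongr
      _ = _ := by ring
  rw [div_div, div_le_iff₀ (by positivity)]
  norm_num at hsq ⊢
  linarith

/-- The two tails of a difference of scaled chi-square variables, added up. -/
theorem measureReal_two_tails_le {Ω : Type*} [MeasurableSpace Ω] {μ : Measure Ω}
    [IsProbabilityMeasure μ] {T D : Ω → ℝ} {n e b : ℝ} (hn : 0 < n)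
    (hG : √(2 * Real.pi / n) * (n / Real.exp 1) ^ n ≤ Real.Gamma n)
    (he0 : 0 < e) (he1 : e < 1) (hb0 : 0 ≤ b) (hb1 : b ≤ 1)
    (hy : 0.6931 ≤ (n + 1) * e ^ 2 / (2 * (1 + e)))
    (hT : HasLaw T (gammaMeasure (n + 1) 1) μ) (hD : AEMeasurable D μ) (hTD : IndepFun D T μ)
    (hmgf : ∀ t, b * t < 1 → mgf D μ t = (1 - b * t) ^ (-(n + 1))) :
    μ.real {ω | (n + 1) * (1 - b) + (n + 1) * e * (1 + b) ≤ T ω - D ω} +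
      μ.real {ω | T ω - D ω ≤ (n + 1) * (1 - b) - (n + 1) * e * (1 + b)} ≤
      2 / 3 * Real.exp (-((n + 1) * e ^ 2 / (2 * (1 + e)))) := by
  set k := n + 1 with hk
  have hk0 : 0 < k := by linarith
  set y := k * e ^ 2 / (2 * (1 + e)) with hyd
  set c := Real.exp (-3) with hc
  obtain ⟨hc1, hc2⟩ := exp_neg_three_bounds
  have hw := inv_sqrt_le_of_log_two_le he0 he1.le hyd hy hn
  set w := 1 / √(2 * Real.pi * n) / e with hwd
  have hw0 : 0 ≤ w := by positivity
  have hint : ∀ t, b * t < 1 → Integrable (fun ω => Real.exp (t * D ω)) μ := by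
    intro t ht
    by_contra hni
    have h0 : mgf D μ t = 0 := integral_undef hni
    rw [hmgf t ht] at h0
    exact (Real.rpow_pos_of_pos (by linarith) _).ne' h0
  have h1e : 0 < 1 + e := by linarith
  have hx : 0 ≤ e * b := by positivity
  have h1x : 0 < 1 + e * b := by linarith
  have hup : μ.real {ω | k * (1 - b) + k * e * (1 + b) ≤ T ω - D ω} ≤
      ((1 - 4 * c) * w + c) * Real.exp (-y) := by
    set z := k * (1 - b) + k * e * (1 + b) with hz
    -- The optimal Chernoff parameter for `b = 0`, where the threshold is `k * (1 + e)`.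
    set τ := e / (1 + e) with hτ
    have hτ0 : 0 < τ := by positivity
    have hτ1 : τ < 1 := by rw [hτ, div_lt_one h1e]; linarith
    have hbt : b * -τ < 1 := by nlinarith
    have hsm : MeasurableSet {p : ℝ × ℝ | p.2 ∈ Set.Ici (z + p.1)} :=
      measurableSet_le (f := fun p : ℝ × ℝ => z + p.1) (by fun_prop) measurable_snd
    have hexp : ∀ d, Real.exp (-(τ * (z + d))) = Real.exp (-(τ * z)) * Real.exp (-τ * d) := by
      intro d; rw [← Real.exp_add]; congr 1; ring
    have h := IndepFun.measureReal_le_mul_mgf hT hD hTD (s := fun d => Set.Ici (z + d))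
      hsm (θ := -τ)
      (C := (1 - τ) ^ (-k) * ((1 - 4 * c) * ((1 - τ) / √(2 * Real.pi * n) / τ) + c)
        * Real.exp (-(τ * z)))
      (fun d => (gammaMeasure_real_Ici_le hn hτ0 hτ1 hG (z + d)).trans_eq (by
        rw [hexp]; ring))
      (hint _ hbt)
    rw [hmgf _ hbt] at h
    have hset : {ω | z ≤ T ω - D ω} = {ω | T ω ∈ Set.Ici (z + D ω)} := by
      ext ω; simp only [Set.mem_ofPred_eq, Set.mem_Ici]; constructor <;> intro <;> linarith
    rw [hset]
    refine h.trans ?_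
    have hpre : (1 - τ) / √(2 * Real.pi * n) / τ = w := by
      rw [hτ, hwd]; field_simp; ring
    rw [hpre]
    have hE := upper_exponent_le hk0.le he0 hb0 hb1
    rw [← hτ, ← hz, ← hyd] at hE
    have : 1 - b * -τ = 1 + b * τ := by ring
    rw [this]
    calc _ = ((1 - 4 * c) * w + c) *
          ((1 - τ) ^ (-k) * Real.exp (-(τ * z)) * (1 + b * τ) ^ (-k)) := by ring
      _ ≤ _ := by
        apply mul_le_mul_of_nonneg_left hE
        have : 0 ≤ 1 - 4 * c := by linarith
        positivity
  have hlow : μ.real {ω | T ω - D ω ≤ k * (1 - b) - k * e * (1 + b)} ≤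
      ((1 - 4 * c) * (1.08 * w) + c) * Real.exp (-y) := by
    set z := k * (1 - b) - k * e * (1 + b) with hz
    -- Chosen so that `1 - b * τ = 1 / (1 + e * b)`: the moment generating function of `D` stays
    -- finite and its logarithm is explicit. At `b = 1` it agrees with the parameter of the upper
    -- tail.
    set τ := e / (1 + e * b) with hτ
    have hτ0 : 0 < τ := by positivity
    have hbt : b * τ < 1 := by
      rw [hτ, ← mul_div_assoc, div_lt_one h1x]; linarith [mul_comm e b]
    have hsm : MeasurableSet {p : ℝ × ℝ | p.2 ∈ Set.Iic (z + p.1)} :=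
      measurableSet_le (g := fun p : ℝ × ℝ => z + p.1) measurable_snd (by fun_prop)
    have hexp : ∀ d, Real.exp (τ * (z + d)) = Real.exp (τ * z) * Real.exp (τ * d) := by
      intro d; rw [← Real.exp_add]; congr 1; ring
    have h := IndepFun.measureReal_le_mul_mgf hT hD hTD (s := fun d => Set.Iic (z + d))
      hsm (θ := τ)
      (C := (1 + τ) ^ (-k) * ((1 - 4 * c) * ((1 + τ) / √(2 * Real.pi * n) / τ) + c)
        * Real.exp (τ * z))
      (fun d => (gammaMeasure_real_Iic_le hn hτ0 hG (z + d)).trans_eq (by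
        rw [hexp]; ring))
      (hint _ hbt)
    rw [hmgf _ hbt] at h
    have hset : {ω | T ω - D ω ≤ z} = {ω | T ω ∈ Set.Iic (z + D ω)} := by
      ext ω; simp only [Set.mem_ofPred_eq, Set.mem_Iic]; constructor <;> intro <;> linarith
    rw [hset]
    refine h.trans ?_
    have hpre : (1 + τ) / √(2 * Real.pi * n) / τ = (1 + e + e * b) * w := by
      rw [hτ, hwd]; field_simp; ring
    rw [hpre]
    have hE := lower_exponent_le hk0.le he0 he1.le hb0 hb1
    rw [← hτ, ← hz, ← hyd] at hE
    obtain ⟨hF1, hF2⟩ := rational_factor_mul_exp_le (y := y) he0.le he1.le hb0 hb1 (by linarith)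
    set X := Real.exp (-(y * (2 * (1 + e) / (1 + e * b) *
      (0.5 + b - b ^ 2 / 2 + (2 * (e * b) + e) / 10))))
    have h4c : 0 ≤ 1 - 4 * c := by linarith
    calc _ = ((1 - 4 * c) * ((1 + e + e * b) * w) + c) *
          ((1 + τ) ^ (-k) * Real.exp (τ * z) * (1 - b * τ) ^ (-k)) := by ring
      _ ≤ ((1 - 4 * c) * ((1 + e + e * b) * w) + c) * X := by
        apply mul_le_mul_of_nonneg_left hE
        positivity
      _ = (1 - 4 * c) * w * ((1 + e + e * b) * X) + c * X := by ring
      _ ≤ (1 - 4 * c) * w * (1.08 * Real.exp (-y)) + c * Real.exp (-y) := by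
        gcongr
      _ = _ := by ring
  -- With `w` replaced by 0.339 the left side decreases in `c`, so the lower bound `0.0487 ≤ exp
  -- (-3)` is what matters; it gives about 0.6652.
  have hnum : ((1 - 4 * c) * w + c) + ((1 - 4 * c) * (1.08 * w) + c) ≤ 2 / 3 := by
    nlinarith [mul_le_mul_of_nonneg_left hw (by linarith : 0 ≤ 1 - 4 * c)]
  calc _ ≤ (((1 - 4 * c) * w + c) + ((1 - 4 * c) * (1.08 * w) + c)) * Real.exp (-y) := by
        linarith
    _ ≤ _ := by gcongr

/-! ### Gaussian moments. -/

/-- Moments are derivatives at 0 of `E t = exp (v t²/2)`; differentiating `p * E` replaces the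
polynomial `p` by `p' + p * v * t`. -/
theorem integral_sq_and_pow_four_gaussianReal (v : ℝ≥0) :
    ∫ x, x ^ 2 ∂(gaussianReal 0 v) = v ∧ ∫ x, x ^ 4 ∂(gaussianReal 0 v) = 3 * (v : ℝ) ^ 2 := by
  have h0 : (0 : ℝ) ∈ interior (integrableExpSet id (gaussianReal 0 v)) := by simp
  set E : ℝ → ℝ := fun t => Real.exp (v * t ^ 2 / 2) with hEd
  have hE : ∀ t, HasDerivAt E (v * t * E t) t := by
    intro t
    have h1 : HasDerivAt (fun t : ℝ => (v : ℝ) * t ^ 2 / 2) (v * t) t := by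
      have := ((hasDerivAt_pow 2 t).const_mul (v : ℝ)).div_const 2
      convert! this using 1; simp; ring
    convert! h1.exp using 1; rw [hEd]; ring
  have hmgf : mgf id (gaussianReal 0 v) = E := by
    rw [mgf_id_gaussianReal]; ext t; simp [hEd]
  have hstep : ∀ (p p' : ℝ → ℝ), (∀ t, HasDerivAt p (p' t) t) →
      deriv (fun t => p t * E t) = fun t => (p' t + p t * (v * t)) * E t := by
    intro p p' hp
    ext t
    have h1 : HasDerivAt (fun t => p t * E t) _ t := (hp t).mul (hE t)
    rw [h1.deriv]; ring
  have d1 : deriv E = fun t => (v * t) * E t := by ext t; rw [(hE t).deriv]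
  have d2 : iteratedDeriv 2 E = fun t => (v + (v * t) * (v * t)) * E t := by
    rw [iteratedDeriv_succ, iteratedDeriv_one, d1]
    exact hstep (fun t => v * t) (fun _ => v) fun t => by
      simpa using (hasDerivAt_id t).const_mul (v : ℝ)
  have d3 : iteratedDeriv 3 E = fun t => (3 * (v : ℝ) ^ 2 * t + v ^ 3 * t ^ 3) * E t := by
    rw [iteratedDeriv_succ, d2, hstep _ (fun t => 2 * (v : ℝ) ^ 2 * t)]
    · ext t; ring
    · intro t
      have := ((hasDerivAt_pow 2 t).const_mul ((v : ℝ) ^ 2)).const_add (v : ℝ)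
      convert! this using 1
      · ext t; ring
      · simp; ring
  have d4 : iteratedDeriv 4 E = fun t => (3 * (v : ℝ) ^ 2 + 3 * v ^ 3 * t ^ 2
      + (3 * (v : ℝ) ^ 2 * t + v ^ 3 * t ^ 3) * (v * t)) * E t := by
    rw [iteratedDeriv_succ, d3]
    refine hstep _ (fun t => 3 * (v : ℝ) ^ 2 + 3 * v ^ 3 * t ^ 2) fun t => ?_
    have := ((hasDerivAt_id t).const_mul (3 * (v : ℝ) ^ 2)).add
      ((hasDerivAt_pow 3 t).const_mul ((v : ℝ) ^ 3))
    convert! this using 1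
    simp; ring
  have e2 := iteratedDeriv_mgf_zero h0 2
  have e4 := iteratedDeriv_mgf_zero h0 4
  rw [hmgf, d2] at e2
  rw [hmgf, d4] at e4
  simp [hEd] at e2 e4
  exact ⟨e2.symm, e4.symm⟩

/-! ### Linear functionals of the Gaussian matrix. -/

section Projection

variable {V Ω : Type*} [MeasurableSpace Ω] {q : ℕ} {R : Ω → Matrix (Fin q) V ℝ}
  {μ : Measure Ω}

theorem IsGaussianProjection.memLp (h : IsGaussianProjection R μ) (i : Fin q) (w : V) :
    MemLp (fun ω => R ω i w) 2 μ :=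
  (h.hasLaw i w).hasGaussianLaw.memLp_two

theorem IsGaussianProjection.covariance_entry [DecidableEq V] (h : IsGaussianProjection R μ)
    (i j : Fin q) (w x : V) :
    cov[fun ω => R ω i w, fun ω => R ω j x; μ] = if i = j ∧ w = x then 1 / (q : ℝ) else 0 := by
  have := h.indep.isProbabilityMeasure
  split_ifs with hc
  · obtain ⟨rfl, rfl⟩ := hc
    rw [covariance_self (h.hasLaw i w).aemeasurable, (h.hasLaw i w).variance_eq,
      variance_id_gaussianReal]
    simp
  · have hne : (i, w) ≠ (j, x) := by simpa using hc
    exact (h.indep.indepFun hne).covariance_eq_zero (h.memLp i w) (h.memLp j x)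

variable [Fintype V]

theorem IsGaussianProjection.hasGaussianLaw (h : IsGaussianProjection R μ) :
    HasGaussianLaw (fun ω (p : Fin q × V) => R ω p.1 p.2) μ :=
  iIndepFun.hasGaussianLaw (X := fun (p : Fin q × V) ω => R ω p.1 p.2)
    (fun p => (h.hasLaw p.1 p.2).hasGaussianLaw) h.indep

theorem IsGaussianProjection.covariance_dotProduct (h : IsGaussianProjection R μ)
    (i j : Fin q) (α β : V → ℝ) :
    cov[fun ω => α ⬝ᵥ R ω i, fun ω => β ⬝ᵥ R ω j; μ] = if i = j then (α ⬝ᵥ β) / q else 0 := by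
  classical
  have := h.indep.isProbabilityMeasure
  simp only [dotProduct]
  rw [covariance_fun_sum_fun_sum (fun w => (h.memLp i w).const_mul _)
    (fun w => (h.memLp j w).const_mul _)]
  simp_rw [covariance_const_mul_left, covariance_const_mul_right, h.covariance_entry]
  by_cases hij : i = j
  · simp [hij, Finset.sum_div]
    refine Finset.sum_congr rfl fun w _ => ?_
    ring
  · simp [hij]

theorem IsGaussianProjection.hasGaussianLaw_dotProduct {κ : Type*} [Fintype κ]
    (h : IsGaussianProjection R μ) (γ : κ → V → ℝ) :
    HasGaussianLaw (fun ω (p : Fin q × κ) => γ p.2 ⬝ᵥ R ω p.1) μ := by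
  let L : (Fin q × V → ℝ) →ₗ[ℝ] (Fin q × κ → ℝ) :=
    { toFun := fun r p => γ p.2 ⬝ᵥ fun w => r (p.1, w)
      map_add' := fun r s => by
        ext p
        simp only [dotProduct, Pi.add_apply, mul_add, Finset.sum_add_distrib]
      map_smul' := fun c r => by
        ext p
        simp only [dotProduct, Pi.smul_apply, smul_eq_mul, Finset.mul_sum, RingHom.id_apply]
        exact Finset.sum_congr rfl fun w _ => by ring }
  exact h.hasGaussianLaw.map_fun L.toContinuousLinearMap

theorem IsGaussianProjection.hasLaw_dotProduct (h : IsGaussianProjection R μ) (i : Fin q)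
    (α : V → ℝ) (v : ℝ≥0) (hv : α ⬝ᵥ α = v) :
    HasLaw (fun ω => √(q : ℝ) * (α ⬝ᵥ R ω i)) (gaussianReal 0 v) μ := by
  have := h.indep.isProbabilityMeasure
  have hq : (0 : ℝ) < q := by exact_mod_cast (Fin.pos i)
  have hg : HasGaussianLaw (fun ω => α ⬝ᵥ R ω i) μ :=
    (h.hasGaussianLaw_dotProduct (κ := Unit) (fun _ => α)).eval (i, ())
  have hmean : ∫ ω, α ⬝ᵥ R ω i ∂μ = 0 := by
    simp only [dotProduct]
    rw [integral_finsetSum _ fun w _ => ((h.memLp i w).integrable (by norm_num)).const_mul _]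
    refine Finset.sum_eq_zero fun w _ => ?_
    rw [integral_const_mul, (h.hasLaw i w).integral_eq, integral_id_gaussianReal, mul_zero]
  have hvar : Var[fun ω => α ⬝ᵥ R ω i; μ] = v / q := by
    rw [← covariance_self hg.aemeasurable, h.covariance_dotProduct, if_pos rfl, hv]
  have hl : HasLaw (fun ω => α ⬝ᵥ R ω i) (gaussianReal 0 (v / q)) μ := by
    refine ⟨hg.aemeasurable, ?_⟩
    rw [hg.map_eq_gaussianReal, hmean, hvar]
    congr 1
    ext; simp; positivity
  convert! gaussianReal_const_mul hl (√(q : ℝ)) using 1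
  rw [mul_zero]
  congr 1
  ext
  simp
  field_simp

/-- The projections are jointly Gaussian, so vanishing covariances, here from orthogonality, already
give independence. -/
theorem IsGaussianProjection.iIndepFun_dotProduct {κ : Type*} [Fintype κ]
    (h : IsGaussianProjection R μ) (γ : κ → V → ℝ) (hγ : ∀ j l, j ≠ l → γ j ⬝ᵥ γ l = 0) :
    iIndepFun (fun (p : Fin q × κ) ω => √(q : ℝ) * (γ p.2 ⬝ᵥ R ω p.1)) μ := by
  have hi : iIndepFun (fun (p : Fin q × κ) ω => γ p.2 ⬝ᵥ R ω p.1) μ := by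
    refine (h.hasGaussianLaw_dotProduct γ).iIndepFun_of_covariance_eq_zero fun p p' hp => ?_
    rw [h.covariance_dotProduct]
    split_ifs with h1
    · rw [hγ _ _ fun h2 => hp (Prod.ext h1 h2), zero_div]
    · rfl
  exact hi.comp (fun _ x => √(q : ℝ) * x) (by fun_prop)

end Projection

/-! ### Normalised rows and polarisation. -/

section Rows

variable {V : Type*} [Fintype V] (A : Matrix V V ℕ)

/-- The row of `A` at `u`, scaled to Euclidean length one. -/
noncomputable def unitRow (u : V) : V → ℝ := fun w => (A u w : ℝ) / √(twoHop A u u : ℝ)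

/-- The cosine similarity of two rows of `A`. -/
noncomputable def rowCosine (u v : V) : ℝ := unitRow A u ⬝ᵥ unitRow A v

/-- Sum and difference of the two unit rows; these are orthogonal. -/
noncomputable def sumDiffRow (u v : V) (j : Bool) : V → ℝ :=
  bif j then unitRow A u + unitRow A v else unitRow A u - unitRow A v

theorem twoHop_eq_dotProduct (u v : V) :
    (twoHop A u v : ℝ) = (fun w => (A u w : ℝ)) ⬝ᵥ fun w => (A v w : ℝ) := by
  simp [twoHop, dotProduct]

variable {A}

theorem twoHop_self_pos {u : V} (hu : 0 < nodeDegree A u) : 0 < twoHop A u u := by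
  rw [pos_iff_ne_zero]
  intro h
  simp only [twoHop, dotProduct, Finset.sum_eq_zero_iff, Finset.mem_univ, true_implies,
    mul_self_eq_zero] at h
  simp [nodeDegree, h] at hu

theorem sqrt_twoHop_pos {u : V} (hu : 0 < nodeDegree A u) : 0 < √(twoHop A u u : ℝ) :=
  Real.sqrt_pos.2 (by exact_mod_cast twoHop_self_pos hu)

theorem rowCosine_eq (u v : V) :
    rowCosine A u v = twoHop A u v / (√(twoHop A u u : ℝ) * √(twoHop A v v : ℝ)) := by
  rw [rowCosine, twoHop_eq_dotProduct A u v]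
  simp only [unitRow, dotProduct, Finset.sum_div]
  exact Finset.sum_congr rfl fun w _ => by rw [div_mul_div_comm]

theorem rowCosine_self {u : V} (hu : 0 < nodeDegree A u) : rowCosine A u u = 1 := by
  have h := sqrt_twoHop_pos hu
  rw [rowCosine_eq, Real.mul_self_sqrt (Nat.cast_nonneg _)]
  exact div_self (by exact_mod_cast (twoHop_self_pos hu).ne')

theorem rowCosine_nonneg (u v : V) : 0 ≤ rowCosine A u v := by
  rw [rowCosine_eq]; positivity

theorem rowCosine_comm (u v : V) : rowCosine A v u = rowCosine A u v := dotProduct_comm _ _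

theorem sumDiffRow_true_dotProduct_self {u v : V} (hu : 0 < nodeDegree A u)
    (hv : 0 < nodeDegree A v) :
    sumDiffRow A u v true ⬝ᵥ sumDiffRow A u v true = 2 + 2 * rowCosine A u v := by
  have h1 := rowCosine_self hu
  have h2 := rowCosine_self hv
  have h3 := rowCosine_comm (A := A) u v
  simp only [sumDiffRow, cond_true, add_dotProduct, dotProduct_add]
  simp only [rowCosine] at *
  rw [h1, h2, h3]; ring

theorem sumDiffRow_false_dotProduct_self {u v : V} (hu : 0 < nodeDegree A u)
    (hv : 0 < nodeDegree A v) :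
    sumDiffRow A u v false ⬝ᵥ sumDiffRow A u v false = 2 - 2 * rowCosine A u v := by
  have h1 := rowCosine_self hu
  have h2 := rowCosine_self hv
  have h3 := rowCosine_comm (A := A) u v
  simp only [sumDiffRow, cond_false, sub_dotProduct, dotProduct_sub]
  simp only [rowCosine] at *
  rw [h1, h2, h3]; ring

theorem rowCosine_le_one {u v : V} (hu : 0 < nodeDegree A u) (hv : 0 < nodeDegree A v) :
    rowCosine A u v ≤ 1 := by
  have h := sumDiffRow_false_dotProduct_self hu hv
  have h0 : 0 ≤ sumDiffRow A u v false ⬝ᵥ sumDiffRow A u v false :=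
    Finset.sum_nonneg fun w _ => mul_self_nonneg _
  linarith

theorem sumDiffRow_orthogonal {u v : V} (hu : 0 < nodeDegree A u) (hv : 0 < nodeDegree A v)
    (j l : Bool) (hjl : j ≠ l) : sumDiffRow A u v j ⬝ᵥ sumDiffRow A u v l = 0 := by
  have h1 := rowCosine_self hu
  have h2 := rowCosine_self hv
  have h3 := rowCosine_comm (A := A) u v
  cases j <;> cases l <;> simp at hjl <;>
    simp only [sumDiffRow, cond_false, cond_true, sub_dotProduct, dotProduct_sub, add_dotProduct,
      dotProduct_add] <;> simp only [rowCosine] at * <;> rw [h1, h2, h3] <;> ring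

/-- The centred dot product of two embedded rows as a difference of sums of squares. -/
theorem embedding_dotProduct_sub {u v : V} (hu : 0 < nodeDegree A u) (hv : 0 < nodeDegree A v)
    {q : ℕ} (hq : 0 < q) (r : Matrix (Fin q) V ℝ) :
    embedding A r u ⬝ᵥ embedding A r v - (twoHop A u v : ℝ) =
      √(twoHop A u u : ℝ) * √(twoHop A v v : ℝ) *
        (1 / (4 * q) * (∑ i, (√(q : ℝ) * (sumDiffRow A u v true ⬝ᵥ r i)) ^ 2
          - ∑ i, (√(q : ℝ) * (sumDiffRow A u v false ⬝ᵥ r i)) ^ 2) - rowCosine A u v) := by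
  have hq0 : (0 : ℝ) < q := by exact_mod_cast hq
  have hsu := sqrt_twoHop_pos hu
  have hsv := sqrt_twoHop_pos hv
  have hrow : ∀ (x : V) (i : Fin q), 0 < √(twoHop A x x : ℝ) →
      embedding A r x i = √(twoHop A x x : ℝ) * (unitRow A x ⬝ᵥ r i) := by
    intro x i hx
    simp only [embedding, Matrix.mul_apply, Matrix.map_apply, Matrix.transpose_apply, unitRow,
      dotProduct, Finset.mul_sum]
    refine Finset.sum_congr rfl fun w _ => ?_
    field_simp
  have hsum : embedding A r u ⬝ᵥ embedding A r v =
      √(twoHop A u u : ℝ) * √(twoHop A v v : ℝ) *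
        ∑ i, (unitRow A u ⬝ᵥ r i) * (unitRow A v ⬝ᵥ r i) := by
    rw [Finset.mul_sum]
    refine Finset.sum_congr rfl fun i _ => ?_
    rw [hrow u i hsu, hrow v i hsv]; ring
  have hpol : 1 / (4 * (q : ℝ)) * (∑ i, (√(q : ℝ) * (sumDiffRow A u v true ⬝ᵥ r i)) ^ 2
      - ∑ i, (√(q : ℝ) * (sumDiffRow A u v false ⬝ᵥ r i)) ^ 2) =
      ∑ i, (unitRow A u ⬝ᵥ r i) * (unitRow A v ⬝ᵥ r i) := by
    rw [← Finset.sum_sub_distrib, Finset.mul_sum]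
    refine Finset.sum_congr rfl fun i _ => ?_
    simp only [sumDiffRow, cond_true, cond_false, add_dotProduct, sub_dotProduct, mul_pow,
      Real.sq_sqrt hq0.le]
    field_simp
    ring
  rw [hpol, hsum, rowCosine_eq]
  field_simp

end Rows

/-! ### Deviation probability for one pair of nodes. -/

section Tail

variable {V Ω : Type*} [Fintype V] [MeasurableSpace Ω] {A : Matrix V V ℕ} {q : ℕ}
  {R : Ω → Matrix (Fin q) V ℝ} {μ : Measure Ω}

/-- The probability that one pair of embedded rows deviates. -/
theorem IsGaussianProjection.measureReal_deviation_le (h : IsGaussianProjection R μ) {u v : V}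
    (hu : 0 < nodeDegree A u) (hv : 0 < nodeDegree A v) {e : ℝ} (he0 : 0 < e) (he1 : e < 1)
    (hy : 0.6931 ≤ q * e ^ 2 / (4 * (1 + e))) :
    μ.real {ω | e * √((twoHop A u u : ℝ) * (twoHop A v v : ℝ)) ≤
        |embedding A (R ω) u ⬝ᵥ embedding A (R ω) v - (twoHop A u v : ℝ)|}
      ≤ 2 / 3 * Real.exp (-(q * e ^ 2 / (4 * (1 + e)))) := by
  have := h.indep.isProbabilityMeasure
  have hq2 : 2 < q := by
    by_contra hq
    have hq' : (q : ℝ) ≤ 2 := by exact_mod_cast not_lt.1 hq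
    have : q * e ^ 2 / (4 * (1 + e)) ≤ 0.5 := by
      rw [div_le_iff₀ (by linarith)]
      nlinarith [sq_nonneg e]
    norm_num at hy this
    linarith
  have hq0 : 0 < q := by omega
  have hqr : (2 : ℝ) < q := by exact_mod_cast hq2
  set ρ := rowCosine A u v with hρ
  have hρ0 : 0 ≤ ρ := rowCosine_nonneg u v
  have hρ1 : ρ ≤ 1 := rowCosine_le_one hu hv
  set vt : ℝ≥0 := ⟨2 + 2 * ρ, by linarith⟩ with hvt
  set vf : ℝ≥0 := ⟨2 - 2 * ρ, by linarith⟩ with hvf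
  have hvtr : (vt : ℝ) = 2 + 2 * ρ := rfl
  have hvfr : (vf : ℝ) = 2 - 2 * ρ := rfl
  set L : Fin q × Bool → Ω → ℝ :=
    fun p ω => √(q : ℝ) * (sumDiffRow A u v p.2 ⬝ᵥ R ω p.1) with hL
  have hLi : iIndepFun L μ := h.iIndepFun_dotProduct _ (sumDiffRow_orthogonal hu hv)
  have hLt : ∀ i, HasLaw (L (i, true)) (gaussianReal 0 vt) μ := fun i =>
    h.hasLaw_dotProduct i _ vt (sumDiffRow_true_dotProduct_self hu hv)
  have hLf : ∀ i, HasLaw (L (i, false)) (gaussianReal 0 vf) μ := fun i =>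
    h.hasLaw_dotProduct i _ vf (sumDiffRow_false_dotProduct_self hu hv)
  have hLm : ∀ p, AEMeasurable (L p) μ := by
    rintro ⟨i, _ | _⟩
    exacts [(hLf i).aemeasurable, (hLt i).aemeasurable]
  have hit : iIndepFun (fun i => L (i, true)) μ :=
    hLi.precomp (g := fun i => (i, true)) fun i j hij => (Prod.ext_iff.1 hij).1
  have hif : iIndepFun (fun i => L (i, false)) μ :=
    hLi.precomp (g := fun i => (i, false)) fun i j hij => (Prod.ext_iff.1 hij).1
  -- Both sums are divided by `2 * vt`, so `T` has rate 1 and `D` carries the scale `b = vf / vt`.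
  -- For `ρ = 1` the variance `vf` is 0 and `D` has no gamma law, so `D` enters only through its
  -- moment generating function.
  set T : Ω → ℝ := fun ω => 1 / (2 * vt : ℝ) * ∑ i, L (i, true) ω ^ 2 with hT
  set D : Ω → ℝ := fun ω => 1 / (2 * vt : ℝ) * ∑ i, L (i, false) ω ^ 2 with hD
  have hTD : IndepFun D T μ := by
    classical
    let S : Bool → Finset (Fin q × Bool) := fun j => Finset.univ.filter fun p => p.2 = j
    have hmem : ∀ j i, (i, j) ∈ S j := fun j i => by simp [S]
    have hdis : Disjoint (S false) (S true) := by
      rw [Finset.disjoint_left]; intro p hp hp'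
      simp [S] at hp hp'; simp [hp] at hp'
    have hind := hLi.indepFun_finset₀ (S false) (S true) hdis hLm
    have hg : ∀ j, Measurable (fun x : S j → ℝ =>
        1 / (2 * vt : ℝ) * ∑ i, x ⟨(i, j), hmem j i⟩ ^ 2) := fun j => by fun_prop
    exact hind.comp (hg false) (hg true)
  have : Nonempty (Fin q) := ⟨⟨0, hq0⟩⟩
  have hvt0 : vt ≠ 0 := by
    intro h0
    have := congrArg NNReal.toReal h0
    rw [hvtr] at this; simp at this; linarith
  -- The gamma shape is `q/2 = n + 1`; Stirling is applied at `n = (q - 2)/2`, which requires `q >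
  -- 2`.
  set n : ℝ := (q : ℝ) / 2 - 1 with hn
  have hn1 : n + 1 = (q : ℝ) / 2 := by rw [hn]; ring
  have hTlaw : HasLaw T (gammaMeasure (n + 1) 1) μ := by
    have := hasLaw_gammaMeasure_sum_sq hvt0 hLt hit
    rw [Fintype.card_fin] at this
    rwa [hn1]
  set b : ℝ := (1 - ρ) / (1 + ρ) with hb
  have h1ρ : 0 < 1 + ρ := by linarith
  have hDm : AEMeasurable D μ :=
    (Finset.aemeasurable_fun_sum _ fun i _ => (hLm (i, false)).pow_const 2).const_mul _
  have hDmgf : ∀ t, b * t < 1 → mgf D μ t = (1 - b * t) ^ (-(n + 1)) := by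
    intro t ht
    have h0 : 0 ≤ 1 - b * t := by linarith
    have h1 : 1 - 2 * (vf : ℝ) * (1 / (2 * vt) * t) = 1 - b * t := by
      rw [hvfr, hvtr, hb]; field_simp
    rw [hD, mgf_sum_sq hLf hif, h1, Fintype.card_fin, hn1, Real.sqrt_eq_rpow,
      ← Real.rpow_neg h0, ← Real.rpow_natCast, ← Real.rpow_mul h0]
    congr 1; ring
  have hG : √(2 * Real.pi / n) * (n / Real.exp 1) ^ n ≤ Real.Gamma n := by
    have := stirling_le_Gamma_half_nat (m := q - 2) (by omega)
    rw [Nat.cast_sub hq2.le] at this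
    have h2 : ((q : ℝ) - (2 : ℕ)) / 2 = n := by rw [hn]; push_cast; ring
    rwa [h2] at this
  have hyn : (n + 1) * e ^ 2 / (2 * (1 + e)) = q * e ^ 2 / (4 * (1 + e)) := by
    rw [hn1]; field_simp; norm_num
  have key := measureReal_two_tails_le (by rw [hn]; linarith) hG he0 he1
    (div_nonneg (by linarith) h1ρ.le : 0 ≤ b) ((div_le_one h1ρ).2 (by linarith) : b ≤ 1)
    (by rw [hyn]; exact hy) hTlaw hDm hTD hDmgf
  rw [hyn] at key
  refine le_trans ?_ key
  refine (measureReal_mono ?_).trans (measureReal_union_le _ _)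
  intro ω hω
  have hω' : e * √((twoHop A u u : ℝ) * (twoHop A v v : ℝ)) ≤
        |embedding A (R ω) u ⬝ᵥ embedding A (R ω) v - (twoHop A u v : ℝ)| := hω
  have hsu := sqrt_twoHop_pos hu
  have hsv := sqrt_twoHop_pos hv
  have hS : embedding A (R ω) u ⬝ᵥ embedding A (R ω) v - (twoHop A u v : ℝ) =
      √(twoHop A u u : ℝ) * √(twoHop A v v : ℝ) * ((1 + ρ) / q * (T ω - D ω) - ρ) := by
    rw [embedding_dotProduct_sub hu hv hq0, hT, hD]
    simp only [hL, hvtr]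
    congr 2
    field_simp
    ring
  rw [hS, Real.sqrt_mul (Nat.cast_nonneg _), abs_mul, abs_of_pos (mul_pos hsu hsv), mul_comm e,
    mul_le_mul_iff_right₀ (mul_pos hsu hsv)] at hω'
  have hq0r : (0 : ℝ) < q := by linarith
  have hTDe : T ω - D ω = q / (1 + ρ) * ((1 + ρ) / q * (T ω - D ω)) := by field_simp
  have hup : (n + 1) * (1 - b) + (n + 1) * e * (1 + b) = q / (1 + ρ) * (ρ + e) := by
    rw [hn1, hb]; field_simp; ring
  have hlo : (n + 1) * (1 - b) - (n + 1) * e * (1 + b) = q / (1 + ρ) * (ρ - e) := by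
    rw [hn1, hb]; field_simp; ring
  have hqρ : 0 ≤ q / (1 + ρ) := by positivity
  rcases le_abs.1 hω' with h1 | h1
  · left
    change (n + 1) * (1 - b) + (n + 1) * e * (1 + b) ≤ T ω - D ω
    rw [hup, hTDe]
    exact mul_le_mul_of_nonneg_left (by linarith) hqρ
  · right
    change T ω - D ω ≤ (n + 1) * (1 - b) - (n + 1) * e * (1 + b)
    rw [hlo, hTDe]
    exact mul_le_mul_of_nonneg_left (by linarith) hqρ

end Tail

/-! ### Central limit theorem for centred squares. -/

/-- The law of `c (x² - v)` for a centred normal variable `x` of variance `v`. -/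
noncomputable def centeredSqLaw (v : ℝ≥0) (c : ℝ) : Measure ℝ :=
  (gaussianReal 0 v).map fun x => c * (x ^ 2 - v)

instance (v : ℝ≥0) (c : ℝ) : IsProbabilityMeasure (centeredSqLaw v c) :=
  Measure.isProbabilityMeasure_map (by fun_prop)

theorem memLp_sq_gaussianReal (v : ℝ≥0) : MemLp (fun x : ℝ => x ^ 2) 2 (gaussianReal 0 v) := by
  have h := (memLp_id_gaussianReal' (μ := 0) (v := v) 4 (by norm_num))
  rw [memLp_two_iff_integrable_sq (by fun_prop)]
  have := h.integrable_norm_pow (p := 4) (by norm_num)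
  refine this.congr (ae_of_all _ fun x => ?_)
  simp only [id, Real.norm_eq_abs]
  rw [← abs_pow, abs_of_nonneg (by positivity)]; ring

theorem memLp_id_centeredSqLaw (v : ℝ≥0) (c : ℝ) : MemLp id 2 (centeredSqLaw v c) := by
  rw [centeredSqLaw, memLp_map_measure_iff (by fun_prop) (by fun_prop)]
  exact ((memLp_sq_gaussianReal v).sub (memLp_const (v : ℝ))).const_mul c

theorem integral_id_centeredSqLaw (v : ℝ≥0) (c : ℝ) : ∫ x, x ∂(centeredSqLaw v c) = 0 := by
  rw [centeredSqLaw, integral_map (by fun_prop) (by fun_prop), integral_const_mul,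
    integral_sub ((memLp_sq_gaussianReal v).integrable (by norm_num)) (integrable_const _),
    (integral_sq_and_pow_four_gaussianReal v).1]
  simp

theorem integral_sq_centeredSqLaw (v : ℝ≥0) (c : ℝ) :
    ∫ x, x ^ 2 ∂(centeredSqLaw v c) = 2 * c ^ 2 * (v : ℝ) ^ 2 := by
  have h2 := (memLp_sq_gaussianReal v).integrable (by norm_num)
  have h4 : Integrable (fun x : ℝ => x ^ 4) (gaussianReal 0 v) :=
    (memLp_sq_gaussianReal v).integrable_sq.congr (ae_of_all _ fun x => by ring)
  obtain ⟨e2, e4⟩ := integral_sq_and_pow_four_gaussianReal v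
  rw [centeredSqLaw, integral_map (by fun_prop) (by fun_prop)]
  have : ∀ x : ℝ, (c * (x ^ 2 - v)) ^ 2 = c ^ 2 * x ^ 4 - 2 * c ^ 2 * v * x ^ 2 + c ^ 2 * v ^ 2 := by
    intro x; ring
  simp_rw [this]
  have h42 : Integrable (fun x : ℝ => c ^ 2 * x ^ 4 - 2 * c ^ 2 * v * x ^ 2)
      (gaussianReal 0 v) := (h4.const_mul _).sub (h2.const_mul _)
  rw [integral_add h42 (integrable_const _),
    integral_sub (h4.const_mul _) (h2.const_mul _), integral_const_mul, integral_const_mul, e2, e4]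
  simp
  ring

/-- Central limit theorem for sums of independent centred squares of normal variables, of two
variances, on varying probability spaces. -/
theorem tendstoInDistribution_sum_centered_sq {Ω : ℕ → Type*} [∀ q, MeasurableSpace (Ω q)]
    (μ : ∀ q, Measure (Ω q)) [∀ q, IsProbabilityMeasure (μ q)]
    (L : ∀ q, Fin q × Bool → Ω q → ℝ) (v : Bool → ℝ≥0) (c : Bool → ℝ)
    (hL : ∀ q p, HasLaw (L q p) (gaussianReal 0 (v p.2)) (μ q))
    (hi : ∀ q, iIndepFun (L q) (μ q))
    (hc : 2 * c true ^ 2 * (v true : ℝ) ^ 2 + 2 * c false ^ 2 * (v false : ℝ) ^ 2 = 1) :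
    TendstoInDistribution
      (fun (q : ℕ) ω => (√(q : ℝ))⁻¹ * ∑ p : Fin q × Bool, c p.2 * (L q p ω ^ 2 - v p.2)) atTop
      (id : ℝ → ℝ) μ (gaussianReal 0 1) where
  forall_aemeasurable q := by
    have := fun p => (hL q p).aemeasurable
    fun_prop
  tendsto := by
    have hLm : ∀ q p, AEMeasurable (fun ω => c p.2 * (L q p ω ^ 2 - v p.2)) (μ q) := fun q p => by
      have := (hL q p).aemeasurable
      fun_prop
    refine ProbabilityMeasure.tendsto_iff_tendsto_charFun.2 fun t => ?_
    set ν : Bool → Measure ℝ := fun j => centeredSqLaw (v j) (c j) with hν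
    have hmt := memLp_id_centeredSqLaw (v true) (c true)
    have hmf := memLp_id_centeredSqLaw (v false) (c false)
    have hft : MemLp (fun p : ℝ × ℝ => p.1) 2 ((ν true).prod (ν false)) :=
      hmt.comp_measurePreserving measurePreserving_fst
    have hff : MemLp (fun p : ℝ × ℝ => p.2) 2 ((ν true).prod (ν false)) :=
      hmf.comp_measurePreserving measurePreserving_snd
    have hI1 : ∫ p : ℝ × ℝ, p.1 ∂((ν true).prod (ν false)) = 0 := by
      rw [integral_fun_fst (fun x => x)]; simp [hν, integral_id_centeredSqLaw]
    have hI2 : ∫ p : ℝ × ℝ, p.2 ∂((ν true).prod (ν false)) = 0 := by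
      rw [integral_fun_snd (fun x => x)]; simp [hν, integral_id_centeredSqLaw]
    -- One i.i.d. summand is the sum of the two coordinates under a fixed product law; only laws
    -- enter, so one limit of characteristic functions serves all the spaces `Ω q`.
    have hbase := tendsto_charFun_inv_sqrt_mul_pow (P := (ν true).prod (ν false))
      (X := fun p => p.1 + p.2) (by fun_prop)
      (by
        rw [integral_add (hft.integrable (by norm_num)) (hff.integrable (by norm_num)), hI1, hI2,
          add_zero])
      (by
        have hs : ∀ p : ℝ × ℝ, ((fun p : ℝ × ℝ => p.1 + p.2) ^ 2) p
            = p.1 ^ 2 + p.2 ^ 2 + 2 * (p.1 * p.2) := by intro p; simp only [Pi.pow_apply]; ring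
        simp_rw [hs]
        have hs2 : Integrable (fun p : ℝ × ℝ => p.1 ^ 2 + p.2 ^ 2) ((ν true).prod (ν false)) :=
          hft.integrable_sq.add hff.integrable_sq
        have hs11 : Integrable (fun p : ℝ × ℝ => 2 * (p.1 * p.2)) ((ν true).prod (ν false)) :=
          (hft.integrable_mul hff).const_mul 2
        rw [integral_add hs2 hs11, integral_add hft.integrable_sq hff.integrable_sq,
          integral_const_mul, integral_prod_mul (fun x => x) (fun x => x),
          integral_fun_fst (fun x => x ^ 2), integral_fun_snd (fun x => x ^ 2)]
        simp only [hν, integral_id_centeredSqLaw, integral_sq_centeredSqLaw]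
        simpa using hc) t
    have hg : charFun ((gaussianReal 0 1).map (id : ℝ → ℝ)) t = Complex.exp (-t ^ 2 / 2) := by
      rw [Measure.map_id, charFun_gaussianReal]; simp [neg_div]
    refine (hbase.congr fun q => ?_).trans (by
      change nhds _ ≤ nhds (charFun ((gaussianReal 0 1).map (id : ℝ → ℝ)) t)
      rw [hg])
    change _ = charFun ((μ q).map _) t
    have hlaw : ∀ p, (μ q).map (fun ω => c p.2 * (L q p ω ^ 2 - v p.2)) = ν p.2 := by
      intro p
      rw [hν]
      simp only [centeredSqLaw]
      rw [← (hL q p).map_eq, AEMeasurable.map_map_of_aemeasurable (by fun_prop)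
        (hL q p).aemeasurable]
      rfl
    have hi2 : iIndepFun (fun p ω => c p.2 * (L q p ω ^ 2 - v p.2)) (μ q) :=
      (hi q).comp (fun p x => c p.2 * (x ^ 2 - v p.2)) (fun p => by fun_prop)
    rw [charFun_map_mul_comp (Finset.aemeasurable_fun_sum _ fun p _ => hLm q p),
      hi2.charFun_map_fun_sum_eq_prod (hLm q), charFun_map_add_prod_eq_mul]
    simp_rw [hlaw]
    rw [Finset.prod_apply, Fintype.prod_prod_type]
    simp

/-! ### Asymptotic normality and the union bound. -/

section Main

variable {V : Type*} [Fintype V] {A : Matrix V V ℕ}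

theorem asymptoticallyNormal_embedding (hA : ∀ u, 0 < nodeDegree A u) {Ω : ℕ → Type*}
    [∀ q, MeasurableSpace (Ω q)] (μ : ∀ q, Measure (Ω q)) [∀ q, IsProbabilityMeasure (μ q)]
    (R : ∀ q, Ω q → Matrix (Fin q) V ℝ) (hR : ∀ q, IsGaussianProjection (R q) (μ q)) (u v : V) :
    AsymptoticallyNormal μ (fun q ω => embedding A (R q ω) u ⬝ᵥ embedding A (R q ω) v)
      (twoHop A u v) (twoHop A u u * twoHop A v v + (twoHop A u v : ℝ) ^ 2) := by
  have hu := hA u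
  have hv := hA v
  set ρ := rowCosine A u v with hρ
  have hρ0 : 0 ≤ ρ := rowCosine_nonneg u v
  have hρ1 : ρ ≤ 1 := rowCosine_le_one hu hv
  set vv : Bool → ℝ≥0 := fun j => ⟨bif j then 2 + 2 * ρ else 2 - 2 * ρ, by
    cases j <;> simp <;> linarith⟩ with hvv
  have hvt : (vv true : ℝ) = 2 + 2 * ρ := rfl
  have hvf : (vv false : ℝ) = 2 - 2 * ρ := rfl
  set σ := √(1 + ρ ^ 2) with hσ
  have hσ0 : 0 < σ := Real.sqrt_pos.2 (by positivity)
  have hσ2 : σ ^ 2 = 1 + ρ ^ 2 := Real.sq_sqrt (by positivity)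
  set c : Bool → ℝ := fun j => bif j then 1 / (4 * σ) else -(1 / (4 * σ)) with hc
  have hsu := sqrt_twoHop_pos hu
  have hsv := sqrt_twoHop_pos hv
  have hnv : √((twoHop A u u : ℝ) * twoHop A v v + (twoHop A u v : ℝ) ^ 2) =
      √(twoHop A u u : ℝ) * √(twoHop A v v : ℝ) * σ := by
    have huv : (twoHop A u v : ℝ) = √(twoHop A u u : ℝ) * √(twoHop A v v : ℝ) * ρ := by
      rw [hρ, rowCosine_eq]; field_simp
    rw [hσ, ← Real.sqrt_mul (Nat.cast_nonneg _), ← Real.sqrt_mul (by positivity), huv,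
      ← Real.sqrt_mul (Nat.cast_nonneg _), mul_pow, Real.sq_sqrt (by positivity)]
    congr 1; ring
  have key := tendstoInDistribution_sum_centered_sq μ
    (fun q p ω => √(q : ℝ) * (sumDiffRow A u v p.2 ⬝ᵥ R q ω p.1)) vv c
    (fun q p => (hR q).hasLaw_dotProduct p.1 _ _ (by
      rcases p with ⟨i, _ | _⟩
      · exact sumDiffRow_false_dotProduct_self hu hv
      · exact sumDiffRow_true_dotProduct_self hu hv))
    (fun q => (hR q).iIndepFun_dotProduct _ (sumDiffRow_orthogonal hu hv))
    -- Unit variance: `2/(16σ²) * ((2 + 2ρ)² + (2 - 2ρ)²) = (1 + ρ²)/σ² = 1`.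
    (by
      rw [hvt, hvf]; simp only [hc, cond_true, cond_false]
      field_simp
      rw [hσ2]; ring)
  unfold AsymptoticallyNormal
  convert! key using 3 with q ω
  -- At `q = 0` both variables vanish identically.
  rcases Nat.eq_zero_or_pos q with rfl | hq
  · simp
  have hq0 : (0 : ℝ) < q := by exact_mod_cast hq
  have hsq : √(q : ℝ) * √(q : ℝ) = q := Real.mul_self_sqrt hq0.le
  have hsq0 : 0 < √(q : ℝ) := Real.sqrt_pos.2 hq0
  rw [embedding_dotProduct_sub hu hv hq, hnv, Fintype.sum_prod_type]
  simp only [Fintype.sum_bool, hvt, hvf, hc, cond_true, cond_false]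
  have hsum : ∑ i, (1 / (4 * σ) * ((√(q : ℝ) * (sumDiffRow A u v true ⬝ᵥ R q ω i)) ^ 2
      - (2 + 2 * ρ)) + -(1 / (4 * σ)) *
        ((√(q : ℝ) * (sumDiffRow A u v false ⬝ᵥ R q ω i)) ^ 2 - (2 - 2 * ρ))) =
      1 / (4 * σ) * (∑ i, (√(q : ℝ) * (sumDiffRow A u v true ⬝ᵥ R q ω i)) ^ 2
        - ∑ i, (√(q : ℝ) * (sumDiffRow A u v false ⬝ᵥ R q ω i)) ^ 2 - 4 * ρ * q) := by
    rw [← Finset.sum_sub_distrib, mul_sub, Finset.mul_sum]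
    have : 1 / (4 * σ) * (4 * ρ * q) = ∑ _i : Fin q, 1 / (4 * σ) * (4 * ρ) := by
      simp; ring
    rw [this, ← Finset.sum_sub_distrib]
    exact Finset.sum_congr rfl fun i _ => by ring
  rw [hsum, ← hρ, inv_mul_eq_div, eq_div_iff hsq0.ne', mul_assoc, hsq]
  field_simp

theorem one_sub_le_measureReal_embedding (hA : ∀ u, 0 < nodeDegree A u)
    (hV : 2 ≤ Fintype.card V) {ε δ : ℝ} (hε : ε ∈ Set.Ioo (0 : ℝ) 1) (hδ : δ ∈ Set.Ioo (0 : ℝ) 1)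
    {q : ℕ} (hq : 4 * ((1 + ε) / ε ^ 2) *
      Real.log ((Fintype.card V : ℝ) * ((Fintype.card V : ℝ) - 1) / δ) ≤ (q : ℝ))
    {Ω : Type*} [MeasurableSpace Ω] (μ : Measure Ω) [IsProbabilityMeasure μ]
    (R : Ω → Matrix (Fin q) V ℝ) (hR : IsGaussianProjection R μ) :
    1 - δ ≤ μ.real {ω | ∀ u v : V,
      |embedding A (R ω) u ⬝ᵥ embedding A (R ω) v - (twoHop A u v : ℝ)|
        < ε * √((twoHop A u u : ℝ) * (twoHop A v v : ℝ))} := by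
  obtain ⟨hε0, hε1⟩ := hε
  obtain ⟨hδ0, hδ1⟩ := hδ
  have hN : (2 : ℝ) ≤ Fintype.card V := by exact_mod_cast hV
  set N : ℝ := (Fintype.card V : ℝ) with hNd
  have hNN : 2 ≤ N * (N - 1) := by nlinarith
  have hlog : Real.log (N * (N - 1) / δ) ≤ q * ε ^ 2 / (4 * (1 + ε)) := by
    rw [le_div_iff₀ (by linarith)]
    calc _ = 4 * ((1 + ε) / ε ^ 2) * Real.log (N * (N - 1) / δ) * ε ^ 2 := by field_simp
      _ ≤ _ := by gcongr
  have hpos : 0 < N * (N - 1) / δ := by positivity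
  have hy : 0.6931 ≤ q * ε ^ 2 / (4 * (1 + ε)) := by
    refine le_trans ?_ hlog
    have h2 : Real.log 2 ≤ Real.log (N * (N - 1) / δ) := by
      apply Real.log_le_log (by norm_num)
      rw [le_div_iff₀ hδ0]; nlinarith
    have := Real.log_two_gt_d9
    norm_num at this ⊢; linarith
  have hexp : Real.exp (-(q * ε ^ 2 / (4 * (1 + ε)))) ≤ δ / (N * (N - 1)) := by
    calc _ ≤ Real.exp (-Real.log (N * (N - 1) / δ)) := Real.exp_le_exp.2 (neg_le_neg hlog)
      _ = _ := by rw [Real.exp_neg, Real.exp_log hpos, inv_div]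
  -- Indexing by unordered pairs halves the off-diagonal count while keeping the diagonal.
  set bad : Sym2 V → Set Ω := fun z => {ω | ∃ u v, s(u, v) = z ∧
    ε * √((twoHop A u u : ℝ) * (twoHop A v v : ℝ)) ≤
      |embedding A (R ω) u ⬝ᵥ embedding A (R ω) v - (twoHop A u v : ℝ)|} with hbad
  have hsymm : ∀ (r : Matrix (Fin q) V ℝ) (u v : V),
      (ε * √((twoHop A u u : ℝ) * (twoHop A v v : ℝ)) ≤
        |embedding A r u ⬝ᵥ embedding A r v - (twoHop A u v : ℝ)|) →
      (ε * √((twoHop A v v : ℝ) * (twoHop A u u : ℝ)) ≤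
        |embedding A r v ⬝ᵥ embedding A r u - (twoHop A v u : ℝ)|) := by
    intro r u v h
    have h1 : twoHop A v u = twoHop A u v := dotProduct_comm _ _
    rwa [h1, dotProduct_comm, mul_comm (twoHop A v v : ℝ)]
  have hbadle : ∀ z, μ.real (bad z) ≤ 2 / 3 * (δ / (N * (N - 1))) := by
    intro z
    induction z using Sym2.ind with
    | _ u v =>
      refine le_trans (measureReal_mono ?_)
        ((hR.measureReal_deviation_le (hA u) (hA v) hε0 hε1 hy).trans (by gcongr))
      rintro ω ⟨u', v', hz, h⟩
      rcases Sym2.eq_iff.1 hz with ⟨rfl, rfl⟩ | ⟨rfl, rfl⟩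
      · exact h
      · exact hsymm _ _ _ h
  set good := {ω | ∀ u v : V,
      |embedding A (R ω) u ⬝ᵥ embedding A (R ω) v - (twoHop A u v : ℝ)|
        < ε * √((twoHop A u u : ℝ) * (twoHop A v v : ℝ))} with hgood
  have hcov : (Set.univ : Set Ω) ⊆ good ∪ ⋃ z, bad z := by
    intro ω _
    by_cases h : ω ∈ good
    · exact Or.inl h
    · right
      have h' : ¬ ∀ u v : V, |embedding A (R ω) u ⬝ᵥ embedding A (R ω) v - (twoHop A u v : ℝ)|
        < ε * √((twoHop A u u : ℝ) * (twoHop A v v : ℝ)) := h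
      push Not at h'
      obtain ⟨u, v, huv⟩ := h'
      exact Set.mem_iUnion.2 ⟨s(u, v), u, v, rfl, huv⟩
  classical
  have hcard : (Fintype.card (Sym2 V) : ℝ) = N * (N + 1) / 2 := by
    rw [Sym2.card, Nat.cast_choose_two]
    push_cast
    ring
  have hsum : μ.real (⋃ z, bad z) ≤ δ := by
    calc μ.real (⋃ z, bad z) ≤ ∑ z, μ.real (bad z) := measureReal_iUnion_fintype_le _
      _ ≤ ∑ _z : Sym2 V, 2 / 3 * (δ / (N * (N - 1))) := Finset.sum_le_sum fun z _ => hbadle z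
      _ = N * (N + 1) / 2 * (2 / 3 * (δ / (N * (N - 1)))) := by
        rw [Finset.sum_const, nsmul_eq_mul, Finset.card_univ, hcard]
      _ = δ * ((N + 1) / (3 * (N - 1))) := by
        have : N - 1 ≠ 0 := by linarith
        field_simp
      -- `N + 1 ≤ 3 (N - 1)` is exactly `N ≥ 2`, with equality at 2; this is what dictates the
      -- constant 2/3.
      _ ≤ δ * 1 := by
        gcongr
        rw [div_le_one (by linarith)]; linarith
      _ = δ := mul_one δ
  have h1 : (1 : ℝ) ≤ μ.real good + μ.real (⋃ z, bad z) := by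
    calc (1 : ℝ) = μ.real Set.univ := by simp
      _ ≤ μ.real (good ∪ ⋃ z, bad z) := measureReal_mono hcov
      _ ≤ _ := measureReal_union_le _ _
  linarith

end Main

theorem mainTheorem11 {V : Type*} [Fintype V] (A : Matrix V V ℕ)
    (hA : ∀ u, 0 < nodeDegree A u) :
    (∀ (Ω : ℕ → Type*) [∀ q, MeasurableSpace (Ω q)] (μ : ∀ q, Measure (Ω q))
        [∀ q, IsProbabilityMeasure (μ q)] (R : ∀ q, Ω q → Matrix (Fin q) V ℝ),
        (∀ q, IsGaussianProjection (R q) (μ q)) →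
        ∀ u v : V,
          AsymptoticallyNormal μ
            (fun q ω => embedding A (R q ω) u ⬝ᵥ embedding A (R q ω) v)
            (twoHop A u v)
            (twoHop A u u * twoHop A v v + (twoHop A u v : ℝ) ^ 2)) ∧
    (2 ≤ Fintype.card V →
      ∀ ε ∈ Set.Ioo (0 : ℝ) 1, ∀ δ ∈ Set.Ioo (0 : ℝ) 1, ∀ q : ℕ,
        4 * ((1 + ε) / ε ^ 2) *
            Real.log ((Fintype.card V : ℝ) * ((Fintype.card V : ℝ) - 1) / δ) ≤ (q : ℝ) →
        ∀ (Ω : Type*) [MeasurableSpace Ω] (μ : Measure Ω) [IsProbabilityMeasure μ]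
          (R : Ω → Matrix (Fin q) V ℝ), IsGaussianProjection R μ →
          1 - δ ≤ μ.real {ω | ∀ u v : V,
            |embedding A (R ω) u ⬝ᵥ embedding A (R ω) v - (twoHop A u v : ℝ)|
              < ε * √((twoHop A u u : ℝ) * (twoHop A v v : ℝ))}) :=
  ⟨fun _ _ μ _ R hR u v => asymptoticallyNormal_embedding hA μ R hR u v,
    fun hV _ hε _ hδ _ hq _ _ μ _ R hR => one_sub_le_measureReal_embedding hA hV hε hδ hq μ R hR⟩
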